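/- **Setting.** Let $f_1,\dots,f_n:\mathbb R^d\to\mathbb R$ be convex and differentiable with $L$-Lipschitz gradients ($L>0$), let $R:\mathbb R^d\to\mathbb R\cup\{+\infty\}$ be proper, closed and convex, let $F=\frac1n\sum_{i=1}^n f_i$ and $P=F+R$, and suppose that $P$ is strongly convex with parameter $\mu>0$: $P(y)\ge P(x)+\xi^T(y-x)+\frac\mu2\|y-x\|^2$ for all $x,y\in\operatorname{dom}R$ and $\xi\in\partial P(x)$. Let $\kappa=L/\mu$ and let $x_*$ be a minimizer of $P$. **Algorithm.** mS2GD with stepsize $h>0$, inner-loop bound $m\ge1$, mini-batch size $b\in\{1,\dots,n\}$ and starting point $x_0\in\mathbb R^d$ does the following in epochs $k=0,1,2,\dots$: compute $g_k=\nabla F(x_k)$; put $y_{k,0}=x_k$; draw $t_k$ uniformly from $\{1,\dots,m\}$; for $t=0,\dots,t_k-1$ draw $A_{kt}$ uniformly among the subsets of $\{1,\dots,n\}$ of size $b$ and put $y_{k,t+1}=\operatorname{prox}_{hR}(y_{k,t}-hG_{k,t})$ with $G_{k,t}=g_k+\frac1b\sum_{i\in A_{kt}}(\nabla f_i(y_{k,t})-\nabla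 f_i(x_k))$; put $x_{k+1}=y_{k,t_k}$. Here $\operatorname{prox}_{hR}(z)=\arg\min_x\{\frac12\|x-z\|^2+hR(x)\}$, and all draws are independent. One unit of work is the evaluation of one component gradient $\nabla f_i$ (including the prox step that may follow it), so an epoch costs $n+2bt_k$ units. **Parameters.** Let $\alpha(b)=\frac{n-b}{b(n-1)}$ and $$b_0=\frac{8n\kappa+8en\kappa+4n}{n\kappa+(7+8e)\kappa+4},\qquad h^b=\sqrt{\Big(\tfrac{1+e}{\mu}\Big)^2+\tfrac{1}{4\mu\alpha(b)L}}-\tfrac{1+e}{\mu},$$ $$m_b=\Big\lceil 8e\,\alpha(b)\,\kappa\Big(e+1+\sqrt{\tfrac{1}{4\alpha(b)\kappa}+(1+e)^2}\Big)\Big\rceil .$$ **Claim.** Let $\epsilon\in(0,1)$, $k=\lceil\log(1/\epsilon)\rceil$, and let the mini-batch size $b\le n$ satisfy $1\le b\le 29$ and $b<\lceil b_0\rceil$. 1. $m_b\ge1$, and mS2GD run with $h=h^b$ and $m=m_b$ satisfies $\mathbb E[P(x_k)-P(x_*)]\le\epsilon\,[P(x_0)-P(x_*)]$, while computing $x_k$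 takes at most $(n+2b\,m_b)\lceil\log(1/\epsilon)\rceil$ units of work. 2. $b\,m_b=O(\kappa)$: for every $\kappa_0>0$ there is a constant $C$, depending only on $\kappa_0$, such that $b\,m_b\le C\kappa$ whenever $\kappa\ge\kappa_0$. 3. The total work is $O((n+\kappa)\log(1/\epsilon))$: for every $\epsilon_0\in(0,1)$ there is a constant $C$, depending only on $\epsilon_0$, such that $(n+2b\,m_b)\lceil\log(1/\epsilon)\rceil\le C\,(n+\kappa)\log(1/\epsilon)$ whenever $0<\epsilon\le\epsilon_0$. 4. If $n\ge1118$, the condition $b<\lceil b_0\rceil$ holds automatically for every $b\le29$ and every $\kappa>0$. -/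

import Mathlib

open Finset
open scoped Gradient ENNReal BigOperators

noncomputable section

namespace MS2GD

variable {d n : ℕ}

/-- The Euclidean space `ℝ^d`. -/
abbrev E (d : ℕ) : Type := EuclideanSpace ℝ (Fin d)

/-! Extended-real-valued convex functions -/

/-- The epigraph of an extended-real-valued function, as a subset of `ℝ^d × ℝ`. -/
def epigraph (R : E d → EReal) : Set (E d × ℝ) := {p | R p.1 ≤ (p.2 : EReal)}

/-- `R : ℝ^d → ℝ ∪ {+∞}` is proper (not identically `+∞`), closed and convex. -/
structure ProperClosedConvex (R : E d → EReal) : Prop where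
  ne_bot : ∀ x, R x ≠ ⊥
  exists_ne_top : ∃ x, R x ≠ ⊤
  convex : Convex ℝ (epigraph R)
  closed : IsClosed (epigraph R)

/-- The subdifferential of an extended-real-valued function at `x`. -/
def subdifferential (P : E d → EReal) (x : E d) : Set (E d) :=
  {ξ | ∀ y, P x + ((inner ℝ ξ (y - x) : ℝ) : EReal) ≤ P y}

/-- Strong convexity with parameter `μ`: for all `x`, `y` in the effective domain and all
`ξ ∈ ∂P(x)`, one has `P(y) ≥ P(x) + ⟨ξ, y - x⟩ + (μ/2) ‖y - x‖²`. -/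
def StronglyConvex (P : E d → EReal) (μ : ℝ) : Prop :=
  ∀ x y, P x ≠ ⊤ → P y ≠ ⊤ → ∀ ξ ∈ subdifferential P x,
    P x + ((inner ℝ ξ (y - x) + μ / 2 * ‖y - x‖ ^ 2 : ℝ) : EReal) ≤ P y

/-- `g` is a convex differentiable function whose gradient is Lipschitz with constant `L`. -/
structure SmoothConvex (g : E d → ℝ) (L : ℝ) : Prop where
  convex : ConvexOn ℝ Set.univ g
  differentiable : Differentiable ℝ g
  lipschitz : ∀ x y, ‖∇ g x - ∇ g y‖ ≤ L * ‖x - y‖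

/-- The composite objective `P = (1/n) ∑ f_i + R`. -/
def objective (f : Fin n → E d → ℝ) (R : E d → EReal) (x : E d) : EReal :=
  (((1 / (n : ℝ)) * ∑ i, f i x : ℝ) : EReal) + R x

/-- The proximal operator `prox_{hR}(z) = argmin_x { ½ ‖x - z‖² + h R(x) }`. -/
def prox (h : ℝ) (R : E d → EReal) (z : E d) : E d :=
  Classical.epsilon fun x => ∀ y,
    ((1 / 2 * ‖x - z‖ ^ 2 : ℝ) : EReal) + (h : EReal) * R x
      ≤ ((1 / 2 * ‖y - z‖ ^ 2 : ℝ) : EReal) + (h : EReal) * R y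

/-! The algorithm. Every state is a pair (current point, units of work spent so far); one unit of
work is charged for each evaluation of a component gradient. -/

/-- Evaluate `∇ f_i(z)` for all `i ∈ S`: the sum of these gradients, and the work this costs. -/
def gradSum (f : Fin n → E d → ℝ) (S : Finset (Fin n)) (z : E d) : E d × ℕ :=
  (∑ i ∈ S, ∇ (f i) z, #S)

lemma minibatches_nonempty {b : ℕ} (hb : b ≤ n) :
    (powersetCard b (univ : Finset (Fin n))).Nonempty :=
  powersetCard_nonempty.2 (by simpa using hb)

lemma lengths_nonempty {m : ℕ} (hm : 0 < m) : (Finset.Icc 1 m).Nonempty :=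
  Finset.nonempty_Icc.2 hm

/-- One inner step with reference point `x` and stored full gradient `g = ∇F(x)`: draw a
mini-batch `A` uniformly among the subsets of `[n]` of size `b`, form the stochastic gradient
`g + (1/b) ∑_{i ∈ A} (∇f_i(y) - ∇f_i(x))` and make a proximal step. -/
def innerStep (f : Fin n → E d → ℝ) (R : E d → EReal) (h : ℝ) {b : ℕ} (hb : b ≤ n)
    (x g : E d) (s : E d × ℕ) : PMF (E d × ℕ) :=
  (PMF.uniformOfFinset (powersetCard b (univ : Finset (Fin n))) (minibatches_nonempty hb)).map
    fun A =>
      let u := gradSum f A s.1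
      let v := gradSum f A x
      (prox h R (s.1 - h • (g + (1 / (b : ℝ)) • (u.1 - v.1))), s.2 + u.2 + v.2)

/-- `t` inner steps, with independent mini-batches. -/
def innerLoop (f : Fin n → E d → ℝ) (R : E d → EReal) (h : ℝ) {b : ℕ} (hb : b ≤ n)
    (x g : E d) : ℕ → E d × ℕ → PMF (E d × ℕ)
  | 0, s => PMF.pure s
  | t + 1, s => (innerLoop f R h hb x g t s).bind (innerStep f R h hb x g)

/-- One epoch: compute the full gradient at the current point, draw the number of inner steps
uniformly from `{1, …, m}`, and run the inner loop from the current point. -/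
def epoch (f : Fin n → E d → ℝ) (R : E d → EReal) (h : ℝ) {b m : ℕ} (hb : b ≤ n) (hm : 0 < m)
    (s : E d × ℕ) : PMF (E d × ℕ) :=
  let u := gradSum f univ s.1
  (PMF.uniformOfFinset (Finset.Icc 1 m) (lengths_nonempty hm)).bind fun t =>
    innerLoop f R h hb s.1 ((1 / (n : ℝ)) • u.1) t (s.1, s.2 + u.2)

/-- The joint law of the outer iterate `x_k` of mS2GD started at `x₀` and of the work spent in
computing it. -/
def run (f : Fin n → E d → ℝ) (R : E d → EReal) (h : ℝ) {b m : ℕ} (hb : b ≤ n) (hm : 0 < m)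
    (x₀ : E d) : ℕ → PMF (E d × ℕ)
  | 0 => PMF.pure (x₀, 0)
  | k + 1 => (run f R h hb hm x₀ k).bind (epoch f R h hb hm)

/-- Expectation of a nonnegative quantity under a discrete law. -/
def expectation {Ω : Type} (p : PMF Ω) (φ : Ω → ℝ≥0∞) : ℝ≥0∞ := ∑' ω, p ω * φ ω

/-- The suboptimality `P(x) - P(x_*)` as an element of `[0, ∞]`; the truncation at `0` is
invisible when `x_*` minimizes `P`. -/
def gap (P : E d → EReal) (xstar x : E d) : ℝ≥0∞ := (P x - P xstar).toENNReal

/-! The parameters -/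

/-- `α(b) = (n - b) / (b (n - 1))`. -/
def alpha (n b : ℕ) : ℝ := ((n : ℝ) - b) / (b * ((n : ℝ) - 1))

/-- The mini-batch threshold `b₀`. -/
def threshold (n : ℕ) (κ : ℝ) : ℝ :=
  (8 * n * κ + 8 * Real.exp 1 * n * κ + 4 * n) / (n * κ + (7 + 8 * Real.exp 1) * κ + 4)

/-- The stepsize `h^b`. -/
def stepsize (n b : ℕ) (L μ : ℝ) : ℝ :=
  √(((1 + Real.exp 1) / μ) ^ 2 + 1 / (4 * μ * alpha n b * L)) - (1 + Real.exp 1) / μ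

/-- The inner-loop length `m_b`. -/
def innerLength (n b : ℕ) (κ : ℝ) : ℕ :=
  ⌈8 * Real.exp 1 * alpha n b * κ *
    (Real.exp 1 + 1 + √(1 / (4 * alpha n b * κ) + (1 + Real.exp 1) ^ 2))⌉₊

/-- The number of outer iterations `⌈log (1/ε)⌉`. -/
def outerIterations (ε : ℝ) : ℕ := ⌈Real.log (1 / ε)⌉₊

end MS2GD

end

/-!
Throughout, `x` is the reference point of an epoch, `α = α(b)`, and the gap is `P - P(x_*)`.

One inner step is an inexact proximal gradient step. For `h ≤ 1/L` it satisfies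
`‖y⁺ - x_*‖² + 2h gap(y⁺) ≤ ‖y - x_*‖² - 2h ⟨Δ, y⁺ - x_*⟩`, where `Δ` is the error of the stochastic
gradient (`prox_step_le`). Replacing `y⁺` in the inner product by the point `q` reached with the
exact gradient makes that term vanish in expectation, and nonexpansiveness of `prox` bounds the
price by `2h² ‖Δ‖²`. Sampling without replacement gives
`𝔼‖Δ‖² ≤ α (1/n) ∑ ‖∇f_i(y) - ∇f_i(x)‖²` (`variance_minibatch_le`), and co-coercivity together with
the optimality of `x_*` bounds the average by `4L (gap(y) + gap(x))`
(`sum_norm_gradient_sub_sq_le_add`). Hence, in expectation,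
`‖y⁺ - x_*‖² + 2h gap(y⁺) ≤ ‖y - x_*‖² + 8h²Lα (gap(y) + gap(x))` (`average_step_le`).

Summing over `t < m`, dividing by `m` (the stopping index is uniform) and using the quadratic growth
`‖x - x_*‖² ≤ (2/μ) gap(x)`, one epoch multiplies the expected gap by at most any `ρ` with
`2/μ + 8h²Lα(m + 1) ≤ ρ (2h - 8h²Lα) m` (`expectation_epoch_le`). The stepsize `h^b` is the positive
root of `4μαLh² + 8(1 + e)αLh = 1`; for it and `m_b` this holds with `ρ = 1/e` (`rate_le`), while
`b < ⌈b₀⌉` is what makes `h^b ≤ 1/L` and rules out `b = n`, where `α = 0`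
(`stepsize_mul_le_one`, `lt_of_lt_threshold`). So `⌈log (1/ε)⌉` epochs suffice.

The inequalities are stated in `[0, ∞]`, where they hold trivially at reference points outside the
domain of `R`; within an epoch all expectations are then finite and real arithmetic applies. The
affine minorant of `R` that makes the proximal points exist is the one given by
the minimizer: `-∇F(x_*)` is a subgradient of `R` at `x_*`.
-/

noncomputable section

namespace MS2GD

variable {d n : ℕ}

/-! ### Smooth convex functions -/

lemma hasDerivAt_le_of_sub_le {φ : ℝ → ℝ} {φ' c : ℝ} (hφ : HasDerivAt φ φ' 0)
    (h : ∀ t, 0 < t → t ≤ 1 → φ t - φ 0 ≤ t * c) : φ' ≤ c := by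
  refine le_of_tendsto (hφ.tendsto_slope_zero_right) ?_
  filter_upwards [Ioc_mem_nhdsGT (zero_lt_one' ℝ)] with t ht
  rw [zero_add, smul_eq_mul, inv_mul_le_iff₀ ht.1]
  exact h t ht.1 ht.2

lemma hasDerivAt_comp_line {g : E d → ℝ} (hg : Differentiable ℝ g) (x v : E d) (t : ℝ) :
    HasDerivAt (fun s : ℝ => g (x + s • v)) (inner ℝ (∇ g (x + t • v)) v) t := by
  have h1 : HasDerivAt (fun s : ℝ => x + s • v) v t := by
    simpa using ((hasDerivAt_id t).smul_const v).const_add x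
  have h2 := (hg (x + t • v)).hasFDerivAt.comp_hasDerivAt t h1
  rwa [← inner_gradient_left] at h2

/-- First-order optimality for a composite objective: at a minimizer `p` of `g + r` over `D`, the
vector `-∇g(p)` is a subgradient of `r`. -/
lemma le_of_isMinOn_add {D : Set (E d)} {r g : E d → ℝ} (hr : ConvexOn ℝ D r)
    (hg : Differentiable ℝ g) {p y : E d} (hp : p ∈ D) (hy : y ∈ D)
    (hmin : ∀ x ∈ D, g p + r p ≤ g x + r x) :
    r p - inner ℝ (∇ g p) (y - p) ≤ r y := by
  have h0 : HasDerivAt (fun s : ℝ => -g (p + s • (y - p))) (-inner ℝ (∇ g p) (y - p)) 0 := by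
    simpa [-inner_gradient_left] using (hasDerivAt_comp_line hg p (y - p) 0).fun_neg
  have h1 : -inner ℝ (∇ g p) (y - p) ≤ r y - r p := by
    refine hasDerivAt_le_of_sub_le h0 fun t ht0 ht1 => ?_
    have e : p + t • (y - p) = (1 - t) • p + t • y := by module
    have hmem := hr.1 hp hy (sub_nonneg.2 ht1) ht0.le (by ring)
    have hc := hr.2 hp hy (sub_nonneg.2 ht1) ht0.le (by ring)
    have hm := hmin _ hmem
    simp only [zero_smul, add_zero, e, smul_eq_mul] at hc hm ⊢
    linarith
  linarith

lemma SmoothConvex.gradient_le {g : E d → ℝ} {L : ℝ} (hg : SmoothConvex g L) (x y : E d) :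
    g x + inner ℝ (∇ g x) (y - x) ≤ g y := by
  have h0 : HasDerivAt (fun s : ℝ => g (x + s • (y - x))) (inner ℝ (∇ g x) (y - x)) 0 := by
    simpa using hasDerivAt_comp_line hg.differentiable x (y - x) 0
  have h1 : inner ℝ (∇ g x) (y - x) ≤ g y - g x := by
    refine hasDerivAt_le_of_sub_le h0 fun t ht0 ht1 => ?_
    have e : x + t • (y - x) = (1 - t) • x + t • y := by module
    have hc := hg.convex.2 (Set.mem_univ x) (Set.mem_univ y) (sub_nonneg.2 ht1) ht0.le (by ring)
    simp only [zero_smul, add_zero, e, smul_eq_mul] at hc ⊢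
    linarith
  linarith

/-- The descent lemma. -/
lemma SmoothConvex.le_quadratic {g : E d → ℝ} {L : ℝ} (hg : SmoothConvex g L) (x y : E d) :
    g y ≤ g x + inner ℝ (∇ g x) (y - x) + L / 2 * ‖y - x‖ ^ 2 := by
  set v := y - x with hv
  have hd : ∀ t : ℝ, HasDerivAt
      (fun s : ℝ => g (x + s • v) - s * inner ℝ (∇ g x) v - L / 2 * ‖v‖ ^ 2 * s ^ 2)
      (inner ℝ (∇ g (x + t • v)) v - 1 * inner ℝ (∇ g x) v
        - L / 2 * ‖v‖ ^ 2 * (2 * t)) t := fun t => by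
    have h2 : HasDerivAt (fun s : ℝ => s ^ 2) (2 * t) t := by simpa using hasDerivAt_pow 2 t
    exact ((hasDerivAt_comp_line hg.differentiable x v t).sub
      ((hasDerivAt_id' t).mul_const _)).sub (h2.const_mul _)
  have hanti : AntitoneOn
      (fun s : ℝ => g (x + s • v) - s * inner ℝ (∇ g x) v - L / 2 * ‖v‖ ^ 2 * s ^ 2)
      (Set.Icc 0 1) := by
    refine antitoneOn_of_deriv_nonpos (convex_Icc 0 1)
      (fun t _ => (hd t).continuousAt.continuousWithinAt)
      (fun t _ => (hd t).differentiableAt.differentiableWithinAt) fun t ht => ?_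
    rw [interior_Icc] at ht
    rw [(hd t).deriv, one_mul, ← inner_sub_left]
    have h1 := real_inner_le_norm (∇ g (x + t • v) - ∇ g x) v
    have h2 := hg.lipschitz (x + t • v) x
    rw [add_sub_cancel_left, norm_smul, Real.norm_of_nonneg ht.1.le] at h2
    nlinarith [mul_le_mul_of_nonneg_right h2 (norm_nonneg v)]
  have := hanti (Set.left_mem_Icc.2 zero_le_one) (Set.right_mem_Icc.2 zero_le_one) zero_le_one
  simp only [hv, one_smul, zero_smul, add_zero, add_sub_cancel, one_mul, one_pow, mul_one, zero_mul,
    sub_zero, ne_eq, OfNat.ofNat_ne_zero, not_false_eq_true, zero_pow, mul_zero] at this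
  rw [hv]
  linarith

/-- Co-coercivity of the gradient, in its function value form. It comes from minimizing the
descent bound: `∇g(y) - ∇g(x)` is the gradient at `y` of the tilted function
`g - g(x) - ⟨∇g(x), · - x⟩ ≥ 0`. -/
lemma SmoothConvex.norm_gradient_sub_sq_le {g : E d → ℝ} {L : ℝ} (hL : 0 < L)
    (hg : SmoothConvex g L) (x y : E d) :
    ‖∇ g y - ∇ g x‖ ^ 2 ≤ 2 * L * (g y - g x - inner ℝ (∇ g x) (y - x)) := by
  set u := ∇ g y - ∇ g x with hu
  have h1 := hg.gradient_le x (y - (1 / L) • u)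
  have h2 := hg.le_quadratic y (y - (1 / L) • u)
  have e1 : y - (1 / L) • u - x = (y - x) - (1 / L) • u := by abel
  have e2 : y - (1 / L) • u - y = -((1 / L) • u) := by abel
  rw [e1, inner_sub_right, real_inner_smul_right] at h1
  rw [e2, inner_neg_right, norm_neg, real_inner_smul_right, norm_smul, mul_pow,
    Real.norm_of_nonneg (by positivity)] at h2
  have h3 : inner ℝ (∇ g y) u - inner ℝ (∇ g x) u = ‖u‖ ^ 2 := by
    rw [← inner_sub_left, ← hu, real_inner_self_eq_norm_sq]
  have h4 : L / 2 * ((1 / L) ^ 2 * ‖u‖ ^ 2) = 1 / L * ‖u‖ ^ 2 / 2 := by field_simp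
  have h5 : 1 / L * ‖u‖ ^ 2 / 2 ≤ g y - g x - inner ℝ (∇ g x) (y - x) := by
    have h6 : 1 / L * inner ℝ (∇ g y) u - 1 / L * inner ℝ (∇ g x) u = 1 / L * ‖u‖ ^ 2 := by
      rw [← h3, mul_sub]
    linarith
  have h6 : ‖u‖ ^ 2 = 2 * L * (1 / L * ‖u‖ ^ 2 / 2) := by field_simp
  rw [h6]
  gcongr

/-- The smooth part `F = (1/n) ∑ f_i` of the objective. -/
def average (f : Fin n → E d → ℝ) (x : E d) : ℝ := 1 / (n : ℝ) * ∑ i, f i x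

lemma gradient_average {f : Fin n → E d → ℝ} (hf : ∀ i, Differentiable ℝ (f i)) (x : E d) :
    ∇ (average f) x = (1 / (n : ℝ)) • ∑ i, ∇ (f i) x := by
  refine HasGradientAt.gradient ?_
  rw [hasGradientAt_iff_hasFDerivAt, map_smul, map_sum]
  simp only [toDual_gradient]
  exact (HasFDerivAt.fun_sum fun i _ => (hf i x).hasFDerivAt).const_mul _

lemma smoothConvex_average {f : Fin n → E d → ℝ} {L : ℝ} (hn : 0 < n)
    (hf : ∀ i, SmoothConvex (f i) L) : SmoothConvex (average f) L where
  convex := by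
    have h : ConvexOn ℝ Set.univ (∑ i, f i) := by
      refine Finset.sum_induction _ (ConvexOn ℝ Set.univ) (fun _ _ => ConvexOn.add)
        (convexOn_const 0 convex_univ) fun i _ => (hf i).convex
    have := h.smul (c := 1 / (n : ℝ)) (by positivity)
    refine this.congr fun x _ => ?_
    simp [average, Finset.sum_apply]
  differentiable := by
    unfold average
    exact (Differentiable.fun_sum fun i _ => (hf i).differentiable).const_mul _
  lipschitz x y := by
    rw [gradient_average fun i => (hf i).differentiable,
      gradient_average fun i => (hf i).differentiable, ← smul_sub, ← Finset.sum_sub_distrib,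
      norm_smul, Real.norm_of_nonneg (by positivity)]
    calc 1 / (n : ℝ) * ‖∑ i, (∇ (f i) x - ∇ (f i) y)‖
        ≤ 1 / (n : ℝ) * ∑ _i : Fin n, L * ‖x - y‖ := by
          gcongr
          exact norm_sum_le_of_le _ fun i _ => (hf i).lipschitz x y
      _ = L * ‖x - y‖ := by
          have : (n : ℝ) ≠ 0 := by positivity
          rw [Finset.sum_const, Finset.card_univ, Fintype.card_fin, nsmul_eq_mul]
          field_simp

/-! ### Extended-real convex functions and the proximal operator -/

/-- The effective domain of an extended-real-valued function. -/
def effectiveDomain (R : E d → EReal) : Set (E d) := {x | R x ≠ ⊤}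

lemma ProperClosedConvex.coe_toReal {R : E d → EReal} (hR : ProperClosedConvex R) {x : E d}
    (hx : x ∈ effectiveDomain R) : ((R x).toReal : EReal) = R x :=
  EReal.coe_toReal hx (hR.ne_bot x)

lemma ProperClosedConvex.mem_epigraph {R : E d → EReal} (hR : ProperClosedConvex R) {x : E d}
    (hx : x ∈ effectiveDomain R) : (x, (R x).toReal) ∈ epigraph R :=
  (hR.coe_toReal hx).ge

lemma ProperClosedConvex.of_mem_epigraph {R : E d → EReal} (hR : ProperClosedConvex R) {x : E d}
    {s : ℝ} (h : (x, s) ∈ epigraph R) : x ∈ effectiveDomain R ∧ (R x).toReal ≤ s := by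
  have hs : R x ≤ (s : EReal) := h
  have hx : x ∈ effectiveDomain R := ne_top_of_le_ne_top (EReal.coe_ne_top s) hs
  refine ⟨hx, ?_⟩
  rwa [← hR.coe_toReal hx, EReal.coe_le_coe_iff] at hs

lemma ProperClosedConvex.convexOn_toReal {R : E d → EReal} (hR : ProperClosedConvex R) :
    ConvexOn ℝ (effectiveDomain R) fun x => (R x).toReal := by
  have key : ∀ x ∈ effectiveDomain R, ∀ y ∈ effectiveDomain R, ∀ a b : ℝ, 0 ≤ a → 0 ≤ b →
      a + b = 1 → (a • x + b • y, a • (R x).toReal + b • (R y).toReal) ∈ epigraph R :=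
    fun x hx y hy a b ha hb hab => hR.convex (hR.mem_epigraph hx) (hR.mem_epigraph hy) ha hb hab
  exact ⟨fun x hx y hy a b ha hb hab => (hR.of_mem_epigraph (key x hx y hy a b ha hb hab)).1,
    fun x hx y hy a b ha hb hab => (hR.of_mem_epigraph (key x hx y hy a b ha hb hab)).2⟩

/-- Existence of proximal points. The affine minorant makes the sublevel sets of
`(x, s) ↦ ½ ‖x - z‖² + h s` on the epigraph compact. -/
lemma ProperClosedConvex.exists_prox {R : E d → EReal} (hR : ProperClosedConvex R) {h : ℝ}
    (hh : 0 < h) {ξ : E d} {c : ℝ}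
    (hξ : ∀ x ∈ effectiveDomain R, inner ℝ ξ x + c ≤ (R x).toReal) (z : E d) :
    ∃ p ∈ effectiveDomain R, ∀ y ∈ effectiveDomain R,
      1 / 2 * ‖p - z‖ ^ 2 + h * (R p).toReal ≤ 1 / 2 * ‖y - z‖ ^ 2 + h * (R y).toReal := by
  obtain ⟨w, hw⟩ : ∃ w, w ∈ effectiveDomain R := hR.exists_ne_top
  let φ : E d × ℝ → ℝ := fun p => 1 / 2 * ‖p.1 - z‖ ^ 2 + h * p.2
  have hφ : Continuous φ := by fun_prop
  let S : Set (E d × ℝ) := epigraph R ∩ {p | φ p ≤ φ (w, (R w).toReal)}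
  have hSc : IsClosed S := hR.closed.inter (isClosed_le hφ continuous_const)
  set K : ℝ := φ (w, (R w).toReal) - h * (inner ℝ ξ z + c) with hK
  set B : ℝ := 2 * (h * ‖ξ‖) + 2 * |K| + 1 with hB
  have hSb : S ⊆ Metric.closedBall z B ×ˢ
      Set.Icc (inner ℝ ξ z + c - ‖ξ‖ * B) (φ (w, (R w).toReal) / h) := by
    rintro ⟨x, s⟩ ⟨hx, hs⟩
    obtain ⟨hxd, hxs⟩ := hR.of_mem_epigraph hx
    have hs' : 1 / 2 * ‖x - z‖ ^ 2 + h * s ≤ φ (w, (R w).toReal) := hs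
    have h1 := hξ x hxd
    have h2 : -(‖ξ‖ * ‖x - z‖) ≤ inner ℝ ξ x - inner ℝ ξ z := by
      rw [← inner_sub_right]
      exact neg_le_of_abs_le (abs_real_inner_le_norm _ _)
    have h3 : inner ℝ ξ z + c - ‖ξ‖ * ‖x - z‖ ≤ s := by linarith
    have h4 : ‖x - z‖ ≤ B := by
      by_contra! hlt
      have h5 := mul_le_mul_of_nonneg_left h3 hh.le
      have h6 : ‖x - z‖ * (‖x - z‖ - 2 * (h * ‖ξ‖)) ≤ 2 * K := by nlinarith
      have h7 : 0 ≤ h * ‖ξ‖ := by positivity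
      have h8 := le_abs_self K
      have h9 := abs_nonneg K
      nlinarith
    refine ⟨by simpa [dist_eq_norm] using h4, ?_, ?_⟩
    · have := mul_le_mul_of_nonneg_left h4 (norm_nonneg ξ)
      exact le_trans (by linarith) h3
    · rw [le_div_iff₀ hh]
      have : 0 ≤ 1 / 2 * ‖x - z‖ ^ 2 := by positivity
      show s * h ≤ _
      linarith
  have hS : IsCompact S := ((isCompact_closedBall z B).prod isCompact_Icc).of_isClosed_subset hSc hSb
  obtain ⟨⟨p, s⟩, hpS, hmin⟩ := hS.exists_isMinOn
    ⟨(w, (R w).toReal), hR.mem_epigraph hw, le_rfl (a := φ _)⟩ hφ.continuousOn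
  obtain ⟨hpd, hps⟩ := hR.of_mem_epigraph hpS.1
  refine ⟨p, hpd, fun y hy => ?_⟩
  have h1 : φ (p, s) ≤ φ (y, (R y).toReal) := by
    rcases le_total (φ (y, (R y).toReal)) (φ (w, (R w).toReal)) with hc | hc
    · exact hmin (show (y, (R y).toReal) ∈ S from ⟨hR.mem_epigraph hy, hc⟩)
    · exact le_trans hpS.2 hc
  have h2 : φ (p, (R p).toReal) ≤ φ (p, s) := by
    show 1 / 2 * ‖p - z‖ ^ 2 + h * (R p).toReal ≤ 1 / 2 * ‖p - z‖ ^ 2 + h * s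
    gcongr
  exact h2.trans h1

/-- The infimum defining `prox` is attained, so `prox` is a minimizer and not a junk value. -/
lemma ProperClosedConvex.prox_spec {R : E d → EReal} (hR : ProperClosedConvex R) {h : ℝ}
    (hh : 0 < h) {ξ : E d} {c : ℝ}
    (hξ : ∀ x ∈ effectiveDomain R, inner ℝ ξ x + c ≤ (R x).toReal) (z : E d) :
    prox h R z ∈ effectiveDomain R ∧ ∀ y ∈ effectiveDomain R,
      1 / 2 * ‖prox h R z - z‖ ^ 2 + h * (R (prox h R z)).toReal
        ≤ 1 / 2 * ‖y - z‖ ^ 2 + h * (R y).toReal := by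
  have hcoe : ∀ x ∈ effectiveDomain R, ((1 / 2 * ‖x - z‖ ^ 2 : ℝ) : EReal) + (h : EReal) * R x
      = ((1 / 2 * ‖x - z‖ ^ 2 + h * (R x).toReal : ℝ) : EReal) := fun x hx => by
    rw [EReal.coe_add, EReal.coe_mul h, hR.coe_toReal hx]
  have htop : ∀ x ∉ effectiveDomain R,
      ((1 / 2 * ‖x - z‖ ^ 2 : ℝ) : EReal) + (h : EReal) * R x = ⊤ := fun x hx => by
    have : R x = ⊤ := not_not.1 hx
    rw [this, EReal.coe_mul_top_of_pos hh, EReal.coe_add_top]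
  obtain ⟨p, hp, hpmin⟩ := hR.exists_prox hh hξ z
  have hspec : ∀ y, ((1 / 2 * ‖prox h R z - z‖ ^ 2 : ℝ) : EReal) + (h : EReal) * R (prox h R z)
      ≤ ((1 / 2 * ‖y - z‖ ^ 2 : ℝ) : EReal) + (h : EReal) * R y := by
    refine Classical.epsilon_spec (p := fun x => ∀ y,
      ((1 / 2 * ‖x - z‖ ^ 2 : ℝ) : EReal) + (h : EReal) * R x
        ≤ ((1 / 2 * ‖y - z‖ ^ 2 : ℝ) : EReal) + (h : EReal) * R y) ⟨p, fun y => ?_⟩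
    by_cases hy : y ∈ effectiveDomain R
    · rw [hcoe p hp, hcoe y hy]
      exact EReal.coe_le_coe_iff.2 (hpmin y hy)
    · rw [htop y hy]
      exact le_top
  have hdom : prox h R z ∈ effectiveDomain R := by
    by_contra hn
    have := hspec p
    rw [htop _ hn, hcoe p hp] at this
    exact EReal.coe_ne_top _ (top_le_iff.1 this)
  refine ⟨hdom, fun y hy => ?_⟩
  have := hspec y
  rwa [hcoe _ hdom, hcoe y hy, EReal.coe_le_coe_iff] at this

/-- The variational inequality of the proximal point: `(z - prox z) / h` is a subgradient of `R`
at `prox z`. -/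
lemma ProperClosedConvex.prox_inner_le {R : E d → EReal} (hR : ProperClosedConvex R) {h : ℝ}
    (hh : 0 < h) {ξ : E d} {c : ℝ}
    (hξ : ∀ x ∈ effectiveDomain R, inner ℝ ξ x + c ≤ (R x).toReal) (z : E d) {y : E d}
    (hy : y ∈ effectiveDomain R) :
    inner ℝ (z - prox h R z) (y - prox h R z)
      ≤ h * ((R y).toReal - (R (prox h R z)).toReal) := by
  obtain ⟨hp, hmin⟩ := hR.prox_spec hh hξ z
  have hgrad : ∀ x, HasGradientAt (fun x : E d => 1 / 2 * ‖x - z‖ ^ 2) (x - z) x := fun x => by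
    rw [hasGradientAt_iff_hasFDerivAt]
    have := (((hasFDerivAt_id x).sub_const z).norm_sq).const_mul (1 / 2 : ℝ)
    refine this.congr_fderiv ?_
    ext v
    simp
  have := le_of_isMinOn_add (hR.convexOn_toReal.smul hh.le)
    (fun x => (hgrad x).differentiableAt) hp hy (by simpa using hmin)
  rw [(hgrad _).gradient] at this
  simp only [smul_eq_mul] at this
  rw [← neg_sub (prox h R z) z, inner_neg_left]
  linarith

lemma ProperClosedConvex.norm_prox_sub_prox_le {R : E d → EReal} (hR : ProperClosedConvex R)
    {h : ℝ} (hh : 0 < h) {ξ : E d} {c : ℝ}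
    (hξ : ∀ x ∈ effectiveDomain R, inner ℝ ξ x + c ≤ (R x).toReal) (z w : E d) :
    ‖prox h R z - prox h R w‖ ≤ ‖z - w‖ := by
  have h1 := hR.prox_inner_le hh hξ z (hR.prox_spec hh hξ w).1
  have h2 := hR.prox_inner_le hh hξ w (hR.prox_spec hh hξ z).1
  set p := prox h R z
  set q := prox h R w
  have h3 : ‖p - q‖ ^ 2 ≤ inner ℝ (z - w) (p - q) := by
    rw [← real_inner_self_eq_norm_sq]
    have e : inner ℝ (p - q) (p - q) - inner ℝ (z - w) (p - q)
        = inner ℝ (z - p) (q - p) + inner ℝ (w - q) (p - q) := by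
      simp only [inner_sub_left, inner_sub_right]
      ring
    linarith
  have h4 := real_inner_le_norm (z - w) (p - q)
  by_contra! hlt
  nlinarith [norm_nonneg (z - w)]

/-! ### The composite problem -/

/-- The standing assumptions: the `f_i` are convex and `L`-smooth, `R` is proper, closed and convex,
`P = (1/n) ∑ f_i + R` is strongly convex with parameter `μ`, and `xstar` minimizes `P`. -/
structure CompositeProblem (f : Fin n → E d → ℝ) (R : E d → EReal) (L μ : ℝ) (xstar : E d) :
    Prop where
  n_pos : 0 < n
  L_pos : 0 < L
  μ_pos : 0 < μ
  smooth : ∀ i, SmoothConvex (f i) L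
  regular : ProperClosedConvex R
  strong : StronglyConvex (objective f R) μ
  minimal : ∀ x, objective f R xstar ≤ objective f R x

/-- The suboptimality `P(x) - P(xstar)` as a real number, meaningful for `x` in the effective
domain of `R`. -/
def realGap (f : Fin n → E d → ℝ) (R : E d → EReal) (xstar x : E d) : ℝ :=
  (average f x + (R x).toReal) - (average f xstar + (R xstar).toReal)

namespace CompositeProblem

variable {f : Fin n → E d → ℝ} {R : E d → EReal} {L μ : ℝ} {xstar : E d}

lemma objective_eq_coe (hp : CompositeProblem f R L μ xstar) {x : E d}
    (hx : x ∈ effectiveDomain R) :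
    objective f R x = ((average f x + (R x).toReal : ℝ) : EReal) := by
  rw [EReal.coe_add, hp.regular.coe_toReal hx]
  rfl

lemma objective_eq_top {x : E d} (hx : x ∉ effectiveDomain R) : objective f R x = ⊤ := by
  have : R x = ⊤ := not_not.1 hx
  rw [objective, this, EReal.coe_add_top]

lemma xstar_mem (hp : CompositeProblem f R L μ xstar) : xstar ∈ effectiveDomain R := by
  by_contra hn
  obtain ⟨w, hw⟩ : ∃ w, w ∈ effectiveDomain R := hp.regular.exists_ne_top
  have := hp.minimal w
  rw [objective_eq_top hn, hp.objective_eq_coe hw] at this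
  exact EReal.coe_ne_top _ (top_le_iff.1 this)

lemma realGap_nonneg (hp : CompositeProblem f R L μ xstar) {x : E d}
    (hx : x ∈ effectiveDomain R) : 0 ≤ realGap f R xstar x := by
  have := hp.minimal x
  rw [hp.objective_eq_coe hx, hp.objective_eq_coe hp.xstar_mem, EReal.coe_le_coe_iff] at this
  exact sub_nonneg.2 this

lemma gap_eq (hp : CompositeProblem f R L μ xstar) {x : E d} (hx : x ∈ effectiveDomain R) :
    gap (objective f R) xstar x = ENNReal.ofReal (realGap f R xstar x) := by
  rw [gap, hp.objective_eq_coe hx, hp.objective_eq_coe hp.xstar_mem, ← EReal.coe_sub,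
    EReal.toENNReal_of_ne_top (EReal.coe_ne_top _), EReal.toReal_coe, realGap]

lemma gap_eq_top (hp : CompositeProblem f R L μ xstar) {x : E d} (hx : x ∉ effectiveDomain R) :
    gap (objective f R) xstar x = ⊤ := by
  rw [gap, objective_eq_top hx, hp.objective_eq_coe hp.xstar_mem, EReal.top_sub_coe,
    EReal.toENNReal_top]

/-- Quadratic growth: strong convexity at `xstar` with the subgradient `0`. -/
lemma norm_sub_sq_le (hp : CompositeProblem f R L μ xstar) {x : E d}
    (hx : x ∈ effectiveDomain R) : ‖x - xstar‖ ^ 2 ≤ 2 / μ * realGap f R xstar x := by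
  have h0 : (0 : E d) ∈ subdifferential (objective f R) xstar := fun y => by
    simpa using hp.minimal y
  have h1 := hp.strong xstar x
    (by rw [hp.objective_eq_coe hp.xstar_mem]; exact EReal.coe_ne_top _)
    (by rw [hp.objective_eq_coe hx]; exact EReal.coe_ne_top _) 0 h0
  rw [hp.objective_eq_coe hp.xstar_mem, hp.objective_eq_coe hx, ← EReal.coe_add,
    EReal.coe_le_coe_iff, inner_zero_left] at h1
  have h2 : μ / 2 * ‖x - xstar‖ ^ 2 ≤ realGap f R xstar x := by
    unfold realGap
    linarith
  have hμ := hp.μ_pos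
  calc ‖x - xstar‖ ^ 2 = 2 / μ * (μ / 2 * ‖x - xstar‖ ^ 2) := by field_simp
    _ ≤ _ := by gcongr

/-- `-∇F(xstar)` is a subgradient of `R` at `xstar`. -/
lemma toReal_ge (hp : CompositeProblem f R L μ xstar) {y : E d} (hy : y ∈ effectiveDomain R) :
    (R xstar).toReal - inner ℝ (∇ (average f) xstar) (y - xstar) ≤ (R y).toReal :=
  le_of_isMinOn_add hp.regular.convexOn_toReal
    (smoothConvex_average hp.n_pos hp.smooth).differentiable hp.xstar_mem hy fun _ hx =>
      sub_nonneg.1 (hp.realGap_nonneg hx)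

/-- The affine minorant of `R` supplied by the minimizer of `P`. -/
lemma affine_minorant (hp : CompositeProblem f R L μ xstar) :
    ∀ x ∈ effectiveDomain R, inner ℝ (-∇ (average f) xstar) x
      + ((R xstar).toReal + inner ℝ (∇ (average f) xstar) xstar) ≤ (R x).toReal := fun x hx => by
  have := hp.toReal_ge hx
  rw [inner_sub_right] at this
  rw [inner_neg_left]
  linarith

lemma prox_mem (hp : CompositeProblem f R L μ xstar) {h : ℝ} (hh : 0 < h) (z : E d) :
    prox h R z ∈ effectiveDomain R :=
  (hp.regular.prox_spec hh hp.affine_minorant z).1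

/-- One inexact proximal gradient step: `G` plays the role of `∇F(y)`. -/
lemma prox_step_le (hp : CompositeProblem f R L μ xstar) {h : ℝ} (hh : 0 < h) (hL : h * L ≤ 1)
    (y G : E d) :
    ‖prox h R (y - h • G) - xstar‖ ^ 2 + 2 * h * realGap f R xstar (prox h R (y - h • G))
      ≤ ‖y - xstar‖ ^ 2
        - 2 * h * inner ℝ (G - ∇ (average f) y) (prox h R (y - h • G) - xstar) := by
  have hF := smoothConvex_average hp.n_pos hp.smooth
  have h1 := hp.regular.prox_inner_le hh hp.affine_minorant (y - h • G) hp.xstar_mem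
  set p := prox h R (y - h • G)
  have h2 := hF.gradient_le y xstar
  have h3 := hF.le_quadratic y p
  have e1 : inner ℝ (y - h • G - p) (xstar - p)
      = inner ℝ (y - p) (xstar - p) - h * inner ℝ G (xstar - p) := by
    rw [← real_inner_smul_left, ← inner_sub_left]
    congr 1
    abel
  have e2 : ‖y - xstar‖ ^ 2
      = ‖y - p‖ ^ 2 + ‖p - xstar‖ ^ 2 - 2 * inner ℝ (y - p) (xstar - p) := by
    have := norm_sub_sq_real (y - p) (xstar - p)
    rw [sub_sub_sub_cancel_right, norm_sub_rev xstar p] at this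
    linarith
  have e3 : inner ℝ (G - ∇ (average f) y) (p - xstar)
      = -inner ℝ G (xstar - p) + inner ℝ (∇ (average f) y) (xstar - y)
        - inner ℝ (∇ (average f) y) (p - y) := by
    simp only [inner_sub_left, inner_sub_right]
    ring
  have h4 : h * L * ‖y - p‖ ^ 2 ≤ ‖y - p‖ ^ 2 := by
    nlinarith [sq_nonneg ‖y - p‖]
  rw [norm_sub_rev p y] at h3
  have h5 := mul_le_mul_of_nonneg_left h2 hh.le
  have h6 := mul_le_mul_of_nonneg_left h3 hh.le
  rw [e1] at h1
  rw [e2, e3, realGap]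
  nlinarith

/-- Averaged co-coercivity: the gradients at `y` are close to those at the minimizer. -/
lemma sum_norm_gradient_sub_sq_le (hp : CompositeProblem f R L μ xstar) {y : E d}
    (hy : y ∈ effectiveDomain R) :
    1 / (n : ℝ) * ∑ i, ‖∇ (f i) y - ∇ (f i) xstar‖ ^ 2 ≤ 2 * L * realGap f R xstar y := by
  have hn : (0 : ℝ) ≤ 1 / n := by positivity
  have h1 : ∑ i, ‖∇ (f i) y - ∇ (f i) xstar‖ ^ 2
      ≤ 2 * L * (∑ i, f i y - ∑ i, f i xstar - inner ℝ (∑ i, ∇ (f i) xstar) (y - xstar)) := by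
    rw [sum_inner, ← Finset.sum_sub_distrib, ← Finset.sum_sub_distrib, Finset.mul_sum]
    exact Finset.sum_le_sum fun i _ => (hp.smooth i).norm_gradient_sub_sq_le hp.L_pos xstar y
  have h2 := hp.toReal_ge hy
  rw [gradient_average fun i => (hp.smooth i).differentiable, real_inner_smul_left] at h2
  calc 1 / (n : ℝ) * ∑ i, ‖∇ (f i) y - ∇ (f i) xstar‖ ^ 2
      ≤ 1 / (n : ℝ) * (2 * L * (∑ i, f i y - ∑ i, f i xstar
          - inner ℝ (∑ i, ∇ (f i) xstar) (y - xstar))) := by gcongr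
    _ = 2 * L * (average f y - average f xstar
          - 1 / (n : ℝ) * inner ℝ (∑ i, ∇ (f i) xstar) (y - xstar)) := by
        unfold average
        ring
    _ ≤ 2 * L * realGap f R xstar y := by
        have := hp.L_pos
        refine mul_le_mul_of_nonneg_left ?_ (by positivity)
        unfold realGap
        linarith

lemma sum_norm_gradient_sub_sq_le_add (hp : CompositeProblem f R L μ xstar) {x y : E d}
    (hx : x ∈ effectiveDomain R) (hy : y ∈ effectiveDomain R) :
    1 / (n : ℝ) * ∑ i, ‖∇ (f i) y - ∇ (f i) x‖ ^ 2
      ≤ 4 * L * (realGap f R xstar y + realGap f R xstar x) := by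
  have h1 := hp.sum_norm_gradient_sub_sq_le hx
  have h2 := hp.sum_norm_gradient_sub_sq_le hy
  have hn : (0 : ℝ) ≤ 1 / n := by positivity
  have h3 : ∑ i, ‖∇ (f i) y - ∇ (f i) x‖ ^ 2 ≤ 2 * (∑ i, ‖∇ (f i) y - ∇ (f i) xstar‖ ^ 2
      + ∑ i, ‖∇ (f i) x - ∇ (f i) xstar‖ ^ 2) := by
    rw [← Finset.sum_add_distrib, Finset.mul_sum]
    refine Finset.sum_le_sum fun i _ => ?_
    have := parallelogram_law_with_norm ℝ (∇ (f i) y - ∇ (f i) xstar)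
      (∇ (f i) x - ∇ (f i) xstar)
    rw [sub_sub_sub_cancel_right] at this
    nlinarith [sq_nonneg ‖∇ (f i) y - ∇ (f i) xstar + (∇ (f i) x - ∇ (f i) xstar)‖]
  have h4 := mul_le_mul_of_nonneg_left h3 hn
  linarith

end CompositeProblem

/-! ### Sampling without replacement -/

lemma card_powersetCard_filter_mem {ι : Type*} [DecidableEq ι] {s : Finset ι} {i : ι} (hi : i ∈ s)
    (b : ℕ) : #{A ∈ powersetCard (b + 1) s | i ∈ A} = (#s - 1).choose b := by
  simpa [hi] using card_filter_powersetCard_subset (s := {i}) (t := s) (n := b + 1)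

lemma sum_powersetCard_sum_mem {ι V : Type*} [DecidableEq ι] [AddCommMonoid V] (s : Finset ι)
    (b : ℕ) (v : ι → V) :
    ∑ A ∈ powersetCard (b + 1) s, ∑ i ∈ A, v i = (#s - 1).choose b • ∑ i ∈ s, v i := by
  have h1 : ∀ A ∈ powersetCard (b + 1) s, ∑ i ∈ A, v i = ∑ i ∈ s, if i ∈ A then v i else 0 :=
    fun A hA => by
      rw [← Finset.sum_filter, Finset.filter_mem_eq_inter,
        Finset.inter_eq_right.2 (mem_powersetCard.1 hA).1]
  rw [Finset.sum_congr rfl h1, Finset.sum_comm, Finset.smul_sum]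
  refine Finset.sum_congr rfl fun i hi => ?_
  rw [← Finset.sum_filter, Finset.sum_const, card_powersetCard_filter_mem hi]

/-- The sample sum of a centered family has mean zero. -/
lemma sum_powersetCard_sum_eq_zero {V : Type*} [AddCommMonoid V] (b : ℕ) {v : Fin n → V}
    (hv : ∑ i, v i = 0) : ∑ A ∈ powersetCard b (univ : Finset (Fin n)), ∑ i ∈ A, v i = 0 := by
  cases b with
  | zero => simp
  | succ b => rw [sum_powersetCard_sum_mem, hv, smul_zero]

/-- The number of `A` of size `b + 1` that contain `i` but not `j`. -/
lemma card_powersetCard_filter_mem_notMem {i j : Fin n} (hij : i ≠ j) (b : ℕ) :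
    #{A ∈ powersetCard (b + 1) (univ : Finset (Fin n)) | i ∈ A ∧ j ∉ A} = (n - 2).choose b := by
  have h : {A ∈ powersetCard (b + 1) (univ : Finset (Fin n)) | i ∈ A ∧ j ∉ A}
      = {A ∈ powersetCard (b + 1) (univ.erase j) | i ∈ A} := by
    ext A
    simp only [mem_filter, mem_powersetCard, subset_univ, true_and, subset_erase]
    tauto
  rw [h, card_powersetCard_filter_mem (by simp [hij]), card_erase_of_mem (mem_univ j), card_univ,
    Fintype.card_fin, Nat.sub_sub]

/-- Second moment of the sample sum of a centered family. Since `∑_{i ∈ A} v_i` is the negative of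
`∑_{j ∉ A} v_j`, only pairs separated by `A` contribute. -/
lemma sum_powersetCard_norm_sq {V : Type*} [NormedAddCommGroup V] [InnerProductSpace ℝ V] (b : ℕ)
    {v : Fin n → V} (hv : ∑ i, v i = 0) :
    ∑ A ∈ powersetCard (b + 1) (univ : Finset (Fin n)), ‖∑ i ∈ A, v i‖ ^ 2
      = (n - 2).choose b * ∑ i, ‖v i‖ ^ 2 := by
  have h1 : ∀ A : Finset (Fin n), ‖∑ i ∈ A, v i‖ ^ 2
      = ∑ i, ∑ j, if i ∈ A ∧ j ∉ A then -inner ℝ (v i) (v j) else 0 := fun A => by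
    have h2 : ∑ i ∈ A, v i = -∑ j ∈ Aᶜ, v j := by
      rw [eq_neg_iff_add_eq_zero, Finset.sum_add_sum_compl, hv]
    have h3 : ‖∑ i ∈ A, v i‖ ^ 2 = ∑ i ∈ A, ∑ j ∈ Aᶜ, -inner ℝ (v i) (v j) := by
      rw [← real_inner_self_eq_norm_sq]
      nth_rw 2 [h2]
      rw [inner_neg_right, sum_inner, ← Finset.sum_neg_distrib]
      refine Finset.sum_congr rfl fun i _ => ?_
      rw [inner_sum, Finset.sum_neg_distrib]
    rw [h3, ← Finset.sum_filter_add_sum_filter_not univ (· ∈ A)]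
    rw [Finset.sum_eq_zero (s := {x ∈ univ | x ∉ A}), add_zero, Finset.filter_mem_eq_inter,
      Finset.univ_inter]
    · refine Finset.sum_congr rfl fun i hi => ?_
      simp only [hi, true_and]
      rw [← Finset.sum_filter]
      congr 1
      ext j
      simp
    · intro i hi
      simp [(mem_filter.1 hi).2]
  have h4 : ∀ i j : Fin n,
      (∑ A ∈ powersetCard (b + 1) (univ : Finset (Fin n)),
        if i ∈ A ∧ j ∉ A then -inner ℝ (v i) (v j) else 0)
      = ((n - 2).choose b : ℝ) * (if i = j then ‖v i‖ ^ 2 else 0)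
        - (n - 2).choose b * inner ℝ (v i) (v j) := fun i j => by
    by_cases hij : i = j
    · subst hij
      simp
    · rw [← Finset.sum_filter, Finset.sum_const, card_powersetCard_filter_mem_notMem hij,
        nsmul_eq_mul, if_neg hij]
      ring
  rw [Finset.sum_congr rfl fun A _ => h1 A, Finset.sum_comm]
  simp_rw [Finset.sum_comm (s := powersetCard _ _), h4, Finset.sum_sub_distrib, ← Finset.mul_sum,
    ← inner_sum, hv]
  simp

lemma choose_mul_sub (b : ℕ) (hb : b + 1 < n) :
    ((n - 2).choose b : ℝ) * n * (n - 1) = n.choose (b + 1) * (b + 1) * (n - (b + 1)) := by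
  obtain ⟨k, rfl⟩ : ∃ k, n = k + 2 := ⟨n - 2, by omega⟩
  have h1 := Nat.add_one_mul_choose_eq (k + 1) b
  have h2 := Nat.choose_mul_succ_eq k b
  rw [Nat.add_sub_cancel]
  have hk : ((k + 1 - b : ℕ) : ℝ) = k + 1 - b := by
    rw [Nat.cast_sub (by omega)]
    push_cast
    ring
  have h1' : ((k : ℝ) + 1 + 1) * (k + 1).choose b = (k + 2).choose (b + 1) * (b + 1) := by
    exact_mod_cast h1
  have h2' : (k.choose b : ℝ) * (k + 1) = (k + 1).choose b * (k + 1 - b) := by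
    rw [← hk]
    exact_mod_cast h2
  push_cast
  calc (k.choose b : ℝ) * (k + 2) * (k + 2 - 1) = (k + 2) * (k.choose b * (k + 1)) := by ring
    _ = (k + 1 + 1) * (k + 1).choose b * (k + 1 - b) := by rw [h2']; ring
    _ = _ := by rw [h1']; ring

/-- Variance of a mini-batch mean under sampling without replacement: it is `α(b)` times the
variance of a single draw. -/
lemma variance_minibatch_le {V : Type*} [NormedAddCommGroup V] [InnerProductSpace ℝ V] {b : ℕ}
    (hb : 1 ≤ b) (hbn : b < n) (v : Fin n → V) :
    1 / (n.choose b : ℝ) * ∑ A ∈ powersetCard b (univ : Finset (Fin n)),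
        ‖(1 / (b : ℝ)) • ∑ i ∈ A, (v i - (1 / (n : ℝ)) • ∑ j, v j)‖ ^ 2
      ≤ alpha n b * (1 / (n : ℝ) * ∑ i, ‖v i‖ ^ 2) := by
  obtain ⟨b, rfl⟩ : ∃ c, b = c + 1 := ⟨b - 1, by omega⟩
  have hn : (n : ℝ) ≠ 0 := by
    have : n ≠ 0 := by omega
    exact_mod_cast this
  have hn1 : (0 : ℝ) < n - 1 := by
    have : ((1 : ℕ) : ℝ) < n := by exact_mod_cast (by omega : 1 < n)
    push_cast at this
    linarith
  have hC : (0 : ℝ) < n.choose (b + 1) := by exact_mod_cast Nat.choose_pos hbn.le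
  have hbn' : ((b : ℝ) + 1) ≤ n := by exact_mod_cast hbn.le
  set m := (1 / (n : ℝ)) • ∑ j, v j with hm
  have hcen : ∑ i, (v i - m) = 0 := by
    rw [Finset.sum_sub_distrib, Finset.sum_const, card_univ, Fintype.card_fin, hm,
      ← Nat.cast_smul_eq_nsmul ℝ, smul_smul, mul_one_div_cancel hn, one_smul, sub_self]
  have hvar : ∑ i, ‖v i - m‖ ^ 2 ≤ ∑ i, ‖v i‖ ^ 2 := by
    have h1 : ∑ i, ‖v i‖ ^ 2 = ∑ i, ‖v i - m‖ ^ 2 + n * ‖m‖ ^ 2 := by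
      have h2 : ∀ i, ‖v i‖ ^ 2 = ‖v i - m‖ ^ 2 + 2 * inner ℝ (v i - m) m + ‖m‖ ^ 2 := fun i => by
        rw [← norm_add_sq_real, sub_add_cancel]
      rw [Finset.sum_congr rfl fun i _ => h2 i, Finset.sum_add_distrib, Finset.sum_add_distrib,
        ← Finset.mul_sum, ← sum_inner, hcen]
      simp
    rw [h1]
    have : 0 ≤ (n : ℝ) * ‖m‖ ^ 2 := by positivity
    linarith
  have hsum : ∑ A ∈ powersetCard (b + 1) (univ : Finset (Fin n)),
        ‖(1 / ((b + 1 : ℕ) : ℝ)) • ∑ i ∈ A, (v i - m)‖ ^ 2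
      = (1 / (b + 1 : ℝ)) ^ 2 * ((n - 2).choose b * ∑ i, ‖v i - m‖ ^ 2) := by
    rw [← sum_powersetCard_norm_sq b hcen, Finset.mul_sum]
    refine Finset.sum_congr rfl fun A _ => ?_
    rw [norm_smul, mul_pow, Real.norm_of_nonneg (by positivity)]
    push_cast
    rfl
  have hch := choose_mul_sub b hbn
  have hcoef : 1 / (n.choose (b + 1) : ℝ) * ((1 / (b + 1 : ℝ)) ^ 2 * (n - 2).choose b)
      = alpha n (b + 1) * (1 / n) := by
    rw [alpha]
    push_cast
    have hb1 : (b : ℝ) + 1 ≠ 0 := by positivity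
    field_simp
    linarith
  rw [hsum]
  calc 1 / (n.choose (b + 1) : ℝ)
        * ((1 / (b + 1 : ℝ)) ^ 2 * ((n - 2).choose b * ∑ i, ‖v i - m‖ ^ 2))
      = alpha n (b + 1) * (1 / n) * ∑ i, ‖v i - m‖ ^ 2 := by rw [← hcoef]; ring
    _ ≤ alpha n (b + 1) * (1 / n) * ∑ i, ‖v i‖ ^ 2 := by
        rw [← hcoef]
        gcongr
    _ = _ := by ring

/-! ### Expectations under discrete laws -/

section Expectation

variable {Ω Ω' : Type}

lemma expectation_pure (a : Ω) (φ : Ω → ℝ≥0∞) : expectation (PMF.pure a) φ = φ a := by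
  classical
  rw [expectation, tsum_eq_single a fun b hb => by simp [PMF.pure_apply, hb]]
  simp

lemma expectation_bind (p : PMF Ω) (q : Ω → PMF Ω') (φ : Ω' → ℝ≥0∞) :
    expectation (p.bind q) φ = expectation p fun a => expectation (q a) φ := by
  simp only [expectation, PMF.bind_apply, ← ENNReal.tsum_mul_right, ← ENNReal.tsum_mul_left]
  rw [ENNReal.tsum_comm]
  simp only [mul_assoc]

lemma expectation_map (p : PMF Ω) (u : Ω → Ω') (φ : Ω' → ℝ≥0∞) :
    expectation (p.map u) φ = expectation p fun a => φ (u a) := by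
  rw [← PMF.bind_pure_comp, expectation_bind]
  simp only [Function.comp_apply, expectation_pure]

lemma expectation_uniformOfFinset (s : Finset Ω) (hs : s.Nonempty) (φ : Ω → ℝ≥0∞) :
    expectation (PMF.uniformOfFinset s hs) φ = (#s : ℝ≥0∞)⁻¹ * ∑ a ∈ s, φ a := by
  rw [expectation, tsum_eq_sum (s := s) fun a ha => by
    rw [PMF.uniformOfFinset_apply_of_notMem _ ha, zero_mul], Finset.mul_sum]
  exact Finset.sum_congr rfl fun a ha => by rw [PMF.uniformOfFinset_apply_of_mem _ ha]

lemma expectation_uniformOfFinset_ofReal (s : Finset Ω) (hs : s.Nonempty) {φ : Ω → ℝ}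
    (hφ : ∀ a ∈ s, 0 ≤ φ a) :
    expectation (PMF.uniformOfFinset s hs) (fun a => ENNReal.ofReal (φ a))
      = ENNReal.ofReal (1 / (#s : ℝ) * ∑ a ∈ s, φ a) := by
  have h0 : (0 : ℝ) < #s := by exact_mod_cast hs.card_pos
  rw [expectation_uniformOfFinset, ENNReal.ofReal_mul (by positivity),
    ENNReal.ofReal_sum_of_nonneg hφ, one_div, ENNReal.ofReal_inv_of_pos h0,
    ENNReal.ofReal_natCast]

lemma expectation_mono (p : PMF Ω) {φ ψ : Ω → ℝ≥0∞} (h : ∀ a, φ a ≤ ψ a) :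
    expectation p φ ≤ expectation p ψ :=
  ENNReal.tsum_le_tsum fun a => mul_le_mul_right (h a) _

lemma expectation_add (p : PMF Ω) (φ ψ : Ω → ℝ≥0∞) :
    expectation p (fun a => φ a + ψ a) = expectation p φ + expectation p ψ := by
  simp only [expectation, mul_add, ENNReal.tsum_add]

lemma expectation_const_mul (p : PMF Ω) (c : ℝ≥0∞) (φ : Ω → ℝ≥0∞) :
    expectation p (fun a => c * φ a) = c * expectation p φ := by
  simp only [expectation, ← ENNReal.tsum_mul_left]
  exact tsum_congr fun a => by ring

lemma expectation_const (p : PMF Ω) (c : ℝ≥0∞) : expectation p (fun _ => c) = c := by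
  rw [expectation, ENNReal.tsum_mul_right, p.tsum_coe, one_mul]

end Expectation

/-! ### One inner step -/

lemma alpha_pos {b : ℕ} (hb : 1 ≤ b) (hbn : b < n) : 0 < alpha n b := by
  have h1 : (b : ℝ) < n := by exact_mod_cast hbn
  have h2 : (1 : ℝ) ≤ b := by exact_mod_cast hb
  exact div_pos (by linarith) (mul_pos (by linarith) (by linarith))

namespace CompositeProblem

variable {f : Fin n → E d → ℝ} {R : E d → EReal} {L μ : ℝ} {xstar : E d}

/-- The expected progress of one inner step. The point `q`, obtained from the exact gradient, does
not depend on the mini-batch, so the error of the stochastic gradient has mean zero against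
`q - xstar`; the remaining error is controlled by nonexpansiveness of `prox` and the variance. -/
lemma average_step_le (hp : CompositeProblem f R L μ xstar) {h : ℝ} (hh : 0 < h)
    (hL : h * L ≤ 1) {b : ℕ} (hb : 1 ≤ b) (hbn : b < n) {x y : E d}
    (hx : x ∈ effectiveDomain R) (hy : y ∈ effectiveDomain R) (p : Finset (Fin n) → E d)
    (hpA : ∀ A, p A = prox h R (y - h • (∇ (average f) x
      + (1 / (b : ℝ)) • (∑ i ∈ A, ∇ (f i) y - ∑ i ∈ A, ∇ (f i) x)))) :
    1 / (n.choose b : ℝ) * ∑ A ∈ powersetCard b (univ : Finset (Fin n)),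
        (‖p A - xstar‖ ^ 2 + 2 * h * realGap f R xstar (p A))
      ≤ ‖y - xstar‖ ^ 2
        + 8 * h ^ 2 * L * alpha n b * (realGap f R xstar y + realGap f R xstar x) := by
  have hC : (0 : ℝ) < n.choose b := by exact_mod_cast Nat.choose_pos hbn.le
  have hb0 : (b : ℝ) ≠ 0 := by
    have : b ≠ 0 := by omega
    exact_mod_cast this
  have hn0 : (n : ℝ) ≠ 0 := by exact_mod_cast hp.n_pos.ne'
  set v : Fin n → E d := fun i => ∇ (f i) y - ∇ (f i) x with hv
  set w : Fin n → E d := fun i => v i - (1 / (n : ℝ)) • ∑ j, v j with hw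
  set q := prox h R (y - h • ∇ (average f) y) with hq
  have hwsum : ∑ i, w i = 0 := by
    rw [hw, Finset.sum_sub_distrib, Finset.sum_const, card_univ, Fintype.card_fin,
      ← Nat.cast_smul_eq_nsmul ℝ, smul_smul, mul_one_div_cancel hn0, one_smul, sub_self]
  have hmean : (1 / (n : ℝ)) • ∑ j, v j = ∇ (average f) y - ∇ (average f) x := by
    rw [gradient_average fun i => (hp.smooth i).differentiable,
      gradient_average fun i => (hp.smooth i).differentiable, ← smul_sub,
      ← Finset.sum_sub_distrib]
  have hstep : ∀ A ∈ powersetCard b (univ : Finset (Fin n)),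
      ‖p A - xstar‖ ^ 2 + 2 * h * realGap f R xstar (p A)
        ≤ ‖y - xstar‖ ^ 2 - 2 * h / b * inner ℝ (∑ i ∈ A, w i) (q - xstar)
          + 2 * h ^ 2 * ‖(1 / (b : ℝ)) • ∑ i ∈ A, w i‖ ^ 2 := fun A hA => by
    set G := ∇ (average f) x + (1 / (b : ℝ)) • (∑ i ∈ A, ∇ (f i) y - ∑ i ∈ A, ∇ (f i) x) with hG
    have hΔ : G - ∇ (average f) y = (1 / (b : ℝ)) • ∑ i ∈ A, w i := by
      rw [hw, Finset.sum_sub_distrib, Finset.sum_const, (mem_powersetCard.1 hA).2, smul_sub,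
        ← Nat.cast_smul_eq_nsmul ℝ, smul_smul, one_div_mul_cancel hb0, one_smul, hmean, hG, hv,
        Finset.sum_sub_distrib]
      abel
    have h1 := hp.prox_step_le hh hL y G
    rw [← hpA A] at h1
    have h2 : ‖p A - q‖ ≤ h * ‖G - ∇ (average f) y‖ := by
      have := hp.regular.norm_prox_sub_prox_le hh hp.affine_minorant (y - h • G)
        (y - h • ∇ (average f) y)
      rw [← hpA A, ← hq, sub_sub_sub_cancel_left, ← smul_sub, norm_smul,
        Real.norm_of_nonneg hh.le, norm_sub_rev (∇ (average f) y)] at this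
      exact this
    set Δ := G - ∇ (average f) y with hΔdef
    have h3 : inner ℝ Δ (p A - xstar) = inner ℝ Δ (p A - q) + inner ℝ Δ (q - xstar) := by
      rw [← inner_add_right, sub_add_sub_cancel]
    have h4 := neg_le_of_abs_le (abs_real_inner_le_norm Δ (p A - q))
    have h5 : ‖Δ‖ * ‖p A - q‖ ≤ h * ‖Δ‖ ^ 2 := by
      nlinarith [mul_le_mul_of_nonneg_left h2 (norm_nonneg Δ)]
    have h6 : 2 * h / b * inner ℝ (∑ i ∈ A, w i) (q - xstar)
        = 2 * h * inner ℝ Δ (q - xstar) := by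
      rw [hΔ, real_inner_smul_left]
      ring
    rw [h6, ← hΔ]
    have h7 : -(h * ‖Δ‖ ^ 2) ≤ inner ℝ Δ (p A - q) := by linarith
    have h8 := mul_le_mul_of_nonneg_left h7 hh.le
    rw [h3] at h1
    linarith
  have hsum : ∑ A ∈ powersetCard b (univ : Finset (Fin n)),
      (‖p A - xstar‖ ^ 2 + 2 * h * realGap f R xstar (p A))
      ≤ n.choose b * ‖y - xstar‖ ^ 2 + 2 * h ^ 2 *
        ∑ A ∈ powersetCard b (univ : Finset (Fin n)), ‖(1 / (b : ℝ)) • ∑ i ∈ A, w i‖ ^ 2 := by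
    refine (Finset.sum_le_sum hstep).trans_eq ?_
    rw [Finset.sum_add_distrib, Finset.sum_sub_distrib, Finset.sum_const, card_powersetCard,
      card_univ, Fintype.card_fin, nsmul_eq_mul, ← Finset.mul_sum, ← Finset.mul_sum, ← sum_inner,
      sum_powersetCard_sum_eq_zero b hwsum, inner_zero_left, mul_zero, sub_zero]
  have hvar := variance_minibatch_le hb hbn v
  have hco := hp.sum_norm_gradient_sub_sq_le_add hx hy
  have hα := alpha_pos hb hbn
  calc 1 / (n.choose b : ℝ) * ∑ A ∈ powersetCard b (univ : Finset (Fin n)),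
        (‖p A - xstar‖ ^ 2 + 2 * h * realGap f R xstar (p A))
      ≤ 1 / (n.choose b : ℝ) * (n.choose b * ‖y - xstar‖ ^ 2 + 2 * h ^ 2 *
          ∑ A ∈ powersetCard b (univ : Finset (Fin n)), ‖(1 / (b : ℝ)) • ∑ i ∈ A, w i‖ ^ 2) := by
        gcongr
    _ = ‖y - xstar‖ ^ 2 + 2 * h ^ 2 * (1 / (n.choose b : ℝ) *
          ∑ A ∈ powersetCard b (univ : Finset (Fin n)),
            ‖(1 / (b : ℝ)) • ∑ i ∈ A, w i‖ ^ 2) := by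
        field_simp
    _ ≤ ‖y - xstar‖ ^ 2 + 2 * h ^ 2 * (alpha n b
          * (4 * L * (realGap f R xstar y + realGap f R xstar x))) := by
        refine add_le_add_right (mul_le_mul_of_nonneg_left ?_ (by positivity)) _
        exact hvar.trans (by gcongr)
    _ = _ := by ring

/-- `average_step_le` in terms of the algorithm. It holds for all points because both sides are
infinite where `P` is. -/
lemma expectation_innerStep_le (hp : CompositeProblem f R L μ xstar) {h : ℝ} (hh : 0 < h)
    (hL : h * L ≤ 1) {b : ℕ} (hb : 1 ≤ b) (hbn : b < n) (x : E d) (s : E d × ℕ) :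
    expectation (innerStep f R h hbn.le x ((1 / (n : ℝ)) • (gradSum f univ x).1) s)
        (fun s' => ENNReal.ofReal (‖s'.1 - xstar‖ ^ 2)
          + ENNReal.ofReal (2 * h) * gap (objective f R) xstar s'.1)
      ≤ ENNReal.ofReal (‖s.1 - xstar‖ ^ 2) + ENNReal.ofReal (8 * h ^ 2 * L * alpha n b)
          * (gap (objective f R) xstar s.1 + gap (objective f R) xstar x) := by
  have hα := alpha_pos hb hbn
  have hL0 := hp.L_pos
  have hc : 0 < 8 * h ^ 2 * L * alpha n b := by positivity
  have htop : ENNReal.ofReal (8 * h ^ 2 * L * alpha n b) * ⊤ = ⊤ :=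
    ENNReal.mul_top (ENNReal.ofReal_pos.2 hc).ne'
  by_cases hx : x ∈ effectiveDomain R
  swap
  · rw [hp.gap_eq_top hx, add_top, htop, add_top]
    exact le_top
  by_cases hy : s.1 ∈ effectiveDomain R
  swap
  · rw [hp.gap_eq_top hy, top_add, htop, add_top]
    exact le_top
  rw [innerStep, expectation_map]
  simp only [gradSum, ← gradient_average (fun i => (hp.smooth i).differentiable)]
  have hmem : ∀ A : Finset (Fin n), prox h R (s.1 - h • (∇ (average f) x
      + (1 / (b : ℝ)) • (∑ i ∈ A, ∇ (f i) s.1 - ∑ i ∈ A, ∇ (f i) x))) ∈ effectiveDomain R :=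
    fun A => hp.prox_mem hh _
  have hterm : ∀ z ∈ effectiveDomain R, ENNReal.ofReal (‖z - xstar‖ ^ 2)
      + ENNReal.ofReal (2 * h) * gap (objective f R) xstar z
      = ENNReal.ofReal (‖z - xstar‖ ^ 2 + 2 * h * realGap f R xstar z) := fun z hz => by
    have := hp.realGap_nonneg hz
    rw [hp.gap_eq hz, ← ENNReal.ofReal_mul (by positivity),
      ← ENNReal.ofReal_add (by positivity) (by positivity)]
  simp only [hterm _ (hmem _)]
  rw [expectation_uniformOfFinset_ofReal]
  swap
  · intro A _
    have := hp.realGap_nonneg (hmem A)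
    positivity
  have h1 := hp.realGap_nonneg hx
  have h2 := hp.realGap_nonneg hy
  rw [hp.gap_eq hx, hp.gap_eq hy, ← ENNReal.ofReal_add h2 h1, ← ENNReal.ofReal_mul hc.le,
    ← ENNReal.ofReal_add (by positivity) (by positivity), card_powersetCard, card_univ,
    Fintype.card_fin]
  exact ENNReal.ofReal_le_ofReal (hp.average_step_le hh hL hb hbn hx hy _ fun _ => rfl)

end CompositeProblem

/-! ### One epoch and the whole run -/

/-- Summation of the one-step inequality over an epoch. -/
lemma sum_le_of_step {a g : ℕ → ℝ} {η c G : ℝ} (ha : ∀ t, 0 ≤ a t) (hg : ∀ t, 0 ≤ g t)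
    (hc : 0 ≤ c) (h0 : g 0 = G)
    (hstep : ∀ t, a (t + 1) + η * g (t + 1) ≤ a t + c * (g t + G)) (m : ℕ) :
    (η - c) * ∑ t ∈ Finset.Icc 1 m, g t ≤ a 0 + c * (m + 1) * G := by
  have key : a m + (η - c) * ∑ t ∈ Finset.Icc 1 m, g t + c * g m ≤ a 0 + c * (m + 1) * G := by
    induction m with
    | zero => simp [h0]
    | succ m ih =>
      rw [Finset.sum_Icc_succ_top (by omega)]
      have := hstep m
      push_cast
      linarith
  have := mul_nonneg hc (hg m)
  linarith [ha m]

namespace CompositeProblem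

variable {f : Fin n → E d → ℝ} {R : E d → EReal} {L μ : ℝ} {xstar : E d}

/-- One epoch contracts the expected suboptimality by `ρ`. -/
lemma expectation_epoch_le (hp : CompositeProblem f R L μ xstar) {h ρ : ℝ} (hh : 0 < h)
    (hL : h * L ≤ 1) {b m : ℕ} (hb : 1 ≤ b) (hbn : b < n) (hm : 0 < m) (hρ0 : 0 < ρ)
    (hc : 8 * h ^ 2 * L * alpha n b < 2 * h)
    (hρ : 2 / μ + 8 * h ^ 2 * L * alpha n b * (m + 1)
      ≤ ρ * ((2 * h - 8 * h ^ 2 * L * alpha n b) * m)) (s : E d × ℕ) :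
    expectation (epoch f R h hbn.le hm s) (fun s' => gap (objective f R) xstar s'.1)
      ≤ ENNReal.ofReal ρ * gap (objective f R) xstar s.1 := by
  have hα := alpha_pos hb hbn
  have hL0 := hp.L_pos
  by_cases hx : s.1 ∈ effectiveDomain R
  swap
  · rw [hp.gap_eq_top hx, ENNReal.mul_top (ENNReal.ofReal_pos.2 hρ0).ne']
    exact le_top
  set c := 8 * h ^ 2 * L * alpha n b with hcdef
  have hc0 : 0 ≤ c := by positivity
  set G := realGap f R xstar s.1 with hG
  have hG0 : 0 ≤ G := hp.realGap_nonneg hx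
  set law : ℕ → PMF (E d × ℕ) := fun t => innerLoop f R h hbn.le s.1
    ((1 / (n : ℝ)) • (gradSum f univ s.1).1) t (s.1, s.2 + (gradSum f univ s.1).2) with hlaw
  set a : ℕ → ℝ≥0∞ := fun t =>
    expectation (law t) fun s' => ENNReal.ofReal (‖s'.1 - xstar‖ ^ 2) with ha
  set g : ℕ → ℝ≥0∞ := fun t =>
    expectation (law t) fun s' => gap (objective f R) xstar s'.1 with hg
  have ha0 : a 0 = ENNReal.ofReal (‖s.1 - xstar‖ ^ 2) := expectation_pure _ _
  have hg0 : g 0 = ENNReal.ofReal G := by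
    rw [← hp.gap_eq hx]
    exact expectation_pure _ _
  have hstep : ∀ t, a (t + 1) + ENNReal.ofReal (2 * h) * g (t + 1)
      ≤ a t + ENNReal.ofReal c * (g t + ENNReal.ofReal G) := fun t => by
    calc a (t + 1) + ENNReal.ofReal (2 * h) * g (t + 1)
        = expectation (law (t + 1)) (fun s' => ENNReal.ofReal (‖s'.1 - xstar‖ ^ 2)
          + ENNReal.ofReal (2 * h) * gap (objective f R) xstar s'.1) := by
          rw [expectation_add, expectation_const_mul]
      _ ≤ expectation (law t) (fun s' => ENNReal.ofReal (‖s'.1 - xstar‖ ^ 2) + ENNReal.ofReal c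
            * (gap (objective f R) xstar s'.1 + gap (objective f R) xstar s.1)) := by
          rw [hlaw]
          simp only [innerLoop]
          rw [expectation_bind]
          exact expectation_mono _ fun s' => hp.expectation_innerStep_le hh hL hb hbn s.1 s'
      _ = a t + ENNReal.ofReal c * (g t + ENNReal.ofReal G) := by
          rw [expectation_add, expectation_const_mul, expectation_add, expectation_const,
            hp.gap_eq hx]
  have hfin : ∀ t, a t ≠ ⊤ ∧ g t ≠ ⊤ := fun t => by
    induction t with
    | zero => exact ⟨by rw [ha0]; exact ENNReal.ofReal_ne_top, by rw [hg0]; exact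
        ENNReal.ofReal_ne_top⟩
    | succ t ih =>
      have h1 : a t + ENNReal.ofReal c * (g t + ENNReal.ofReal G) ≠ ⊤ :=
        ENNReal.add_ne_top.2 ⟨ih.1, ENNReal.mul_ne_top ENNReal.ofReal_ne_top
          (ENNReal.add_ne_top.2 ⟨ih.2, ENNReal.ofReal_ne_top⟩)⟩
      have h2 := ENNReal.add_ne_top.1 (ne_top_of_le_ne_top h1 (hstep t))
      refine ⟨h2.1, fun h3 => h2.2 ?_⟩
      rw [h3, ENNReal.mul_top (ENNReal.ofReal_pos.2 (by positivity)).ne']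
  have hstepR : ∀ t, (a (t + 1)).toReal + 2 * h * (g (t + 1)).toReal
      ≤ (a t).toReal + c * ((g t).toReal + G) := fun t => by
    have h1 : a t + ENNReal.ofReal c * (g t + ENNReal.ofReal G) ≠ ⊤ :=
      ENNReal.add_ne_top.2 ⟨(hfin t).1, ENNReal.mul_ne_top ENNReal.ofReal_ne_top
        (ENNReal.add_ne_top.2 ⟨(hfin t).2, ENNReal.ofReal_ne_top⟩)⟩
    have h2 := ENNReal.toReal_mono h1 (hstep t)
    rwa [ENNReal.toReal_add (hfin _).1 (ENNReal.mul_ne_top ENNReal.ofReal_ne_top (hfin _).2),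
      ENNReal.toReal_add (hfin _).1 (ENNReal.mul_ne_top ENNReal.ofReal_ne_top
        (ENNReal.add_ne_top.2 ⟨(hfin t).2, ENNReal.ofReal_ne_top⟩)), ENNReal.toReal_mul,
      ENNReal.toReal_mul, ENNReal.toReal_add (hfin _).2 ENNReal.ofReal_ne_top,
      ENNReal.toReal_ofReal (by positivity), ENNReal.toReal_ofReal hc0,
      ENNReal.toReal_ofReal hG0] at h2
  have hsum := sum_le_of_step (a := fun t => (a t).toReal) (g := fun t => (g t).toReal)
    (fun _ => ENNReal.toReal_nonneg) (fun _ => ENNReal.toReal_nonneg) hc0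
    (by simp only [hg0, ENNReal.toReal_ofReal hG0]) hstepR m
  simp only [ha0, ENNReal.toReal_ofReal (sq_nonneg ‖s.1 - xstar‖)] at hsum
  have hm0 : (0 : ℝ) < m := by exact_mod_cast hm
  have hbound : 1 / (m : ℝ) * ∑ t ∈ Finset.Icc 1 m, (g t).toReal ≤ ρ * G := by
    have h1 : (2 * h - c) * ∑ t ∈ Finset.Icc 1 m, (g t).toReal
        ≤ (2 * h - c) * (ρ * m * G) := by
      have h2 := mul_le_mul_of_nonneg_right hρ hG0
      have h3 := hp.norm_sub_sq_le hx
      linarith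
    have h4 := le_of_mul_le_mul_left h1 (sub_pos.2 hc)
    rw [one_div, inv_mul_le_iff₀ hm0]
    linarith
  rw [epoch, expectation_bind, hp.gap_eq hx, ← ENNReal.ofReal_mul hρ0.le]
  calc expectation (PMF.uniformOfFinset (Finset.Icc 1 m) (lengths_nonempty hm)) g
      = expectation (PMF.uniformOfFinset (Finset.Icc 1 m) (lengths_nonempty hm))
          (fun t => ENNReal.ofReal (g t).toReal) := by
        simp only [fun t => ENNReal.ofReal_toReal (hfin t).2]
    _ = ENNReal.ofReal (1 / (m : ℝ) * ∑ t ∈ Finset.Icc 1 m, (g t).toReal) := by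
        rw [expectation_uniformOfFinset_ofReal _ _ fun _ _ => ENNReal.toReal_nonneg, Nat.card_Icc,
          Nat.add_sub_cancel]
    _ ≤ ENNReal.ofReal (ρ * G) := ENNReal.ofReal_le_ofReal hbound

/-- Linear convergence of mS2GD with rate `ρ`. -/
lemma expectation_run_le (hp : CompositeProblem f R L μ xstar) {h ρ : ℝ} (hh : 0 < h)
    (hL : h * L ≤ 1) {b m : ℕ} (hb : 1 ≤ b) (hbn : b < n) (hm : 0 < m) (hρ0 : 0 < ρ)
    (hc : 8 * h ^ 2 * L * alpha n b < 2 * h)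
    (hρ : 2 / μ + 8 * h ^ 2 * L * alpha n b * (m + 1)
      ≤ ρ * ((2 * h - 8 * h ^ 2 * L * alpha n b) * m)) (x₀ : E d) (k : ℕ) :
    expectation (run f R h hbn.le hm x₀ k) (fun s => gap (objective f R) xstar s.1)
      ≤ ENNReal.ofReal ρ ^ k * gap (objective f R) xstar x₀ := by
  induction k with
  | zero => rw [run, expectation_pure, pow_zero, one_mul]
  | succ k ih =>
    rw [run, expectation_bind]
    calc _ ≤ expectation (run f R h hbn.le hm x₀ k)
          (fun s => ENNReal.ofReal ρ * gap (objective f R) xstar s.1) :=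
          expectation_mono _ fun s => hp.expectation_epoch_le hh hL hb hbn hm hρ0 hc hρ s
      _ ≤ ENNReal.ofReal ρ * (ENNReal.ofReal ρ ^ k * gap (objective f R) xstar x₀) := by
          rw [expectation_const_mul]
          gcongr
      _ = _ := by rw [pow_succ']; ring

end CompositeProblem

/-! ### Work -/

lemma work_innerLoop {f : Fin n → E d → ℝ} {R : E d → EReal} {h : ℝ} {b : ℕ} {hb : b ≤ n}
    {x g : E d} {s : E d × ℕ} (t : ℕ) :
    ∀ s' ∈ (innerLoop f R h hb x g t s).support, s'.2 = s.2 + 2 * b * t := by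
  induction t with
  | zero => simp [innerLoop]
  | succ t ih =>
    intro s' hs'
    rw [innerLoop, PMF.mem_support_bind_iff] at hs'
    obtain ⟨s₁, hs₁, hs'⟩ := hs'
    rw [innerStep, PMF.mem_support_map_iff] at hs'
    obtain ⟨A, hA, rfl⟩ := hs'
    rw [PMF.mem_support_uniformOfFinset_iff, mem_powersetCard] at hA
    simp only [gradSum, hA.2, ih s₁ hs₁]
    ring

lemma work_run_le {f : Fin n → E d → ℝ} {R : E d → EReal} {h : ℝ} {b m : ℕ} {hb : b ≤ n}
    {hm : 0 < m} {x₀ : E d} (k : ℕ) :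
    ∀ s ∈ (run f R h hb hm x₀ k).support, s.2 ≤ (n + 2 * b * m) * k := by
  induction k with
  | zero => simp [run]
  | succ k ih =>
    intro s hs
    rw [run, PMF.mem_support_bind_iff] at hs
    obtain ⟨s₁, hs₁, hs⟩ := hs
    rw [epoch, PMF.mem_support_bind_iff] at hs
    obtain ⟨t, ht, hs⟩ := hs
    rw [PMF.mem_support_uniformOfFinset_iff, Finset.mem_Icc] at ht
    rw [work_innerLoop t s hs]
    simp only [gradSum, card_univ, Fintype.card_fin]
    have h1 := ih s₁ hs₁
    have h2 : 2 * b * t ≤ 2 * b * m := Nat.mul_le_mul_left _ ht.2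
    linarith

/-! ### The parameters -/

/-- The condition `b < ⌈b₀⌉`, cleared of denominators. -/
lemma lt_ceil_threshold_iff {b : ℕ} {κ : ℝ} (hκ : 0 < κ) :
    b < ⌈threshold n κ⌉₊ ↔ (b : ℝ) * (n * κ + (7 + 8 * Real.exp 1) * κ + 4)
      < 8 * n * κ + 8 * Real.exp 1 * n * κ + 4 * n := by
  rw [Nat.lt_ceil, threshold, lt_div_iff₀ (by positivity)]

/-- The threshold `b₀` is at most `n`, so full batches, for which `α(b) = 0`, are excluded. -/
lemma lt_of_lt_threshold {b : ℕ} {κ : ℝ} (hκ : 0 < κ) (hb : 1 ≤ b) (hbn : b ≤ n)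
    (h : b < ⌈threshold n κ⌉₊) : b < n := by
  rw [lt_ceil_threshold_iff hκ] at h
  refine lt_of_le_of_ne hbn fun heq => ?_
  subst heq
  have h1 : (1 : ℝ) ≤ b := by exact_mod_cast hb
  have h2 : 0 ≤ (b : ℝ) * κ * (b - 1) := by
    have : (0 : ℝ) ≤ b - 1 := by linarith
    positivity
  nlinarith

lemma le_alpha_mul_of_lt_threshold {b : ℕ} {κ : ℝ} (hκ : 0 < κ) (hb : 1 ≤ b) (hbn : b < n)
    (h : b < ⌈threshold n κ⌉₊) : κ ≤ alpha n b * (4 + 8 * (1 + Real.exp 1) * κ) := by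
  rw [lt_ceil_threshold_iff hκ] at h
  have h1 : (1 : ℝ) ≤ b := by exact_mod_cast hb
  have h2 : (b : ℝ) < n := by exact_mod_cast hbn
  have h3 : (0 : ℝ) < b * (n - 1) := mul_pos (by linarith) (by linarith)
  rw [alpha, div_mul_eq_mul_div, le_div_iff₀ h3]
  linarith

lemma alpha_le_one {b : ℕ} (hb : 1 ≤ b) (hbn : b < n) : alpha n b ≤ 1 := by
  have h1 : (1 : ℝ) ≤ b := by exact_mod_cast hb
  have h2 : (b : ℝ) < n := by exact_mod_cast hbn
  rw [alpha, div_le_one (mul_pos (by linarith) (by linarith))]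
  nlinarith

lemma stepsize_pos {b : ℕ} {L μ : ℝ} (hL : 0 < L) (hμ : 0 < μ) (hb : 1 ≤ b) (hbn : b < n) :
    0 < stepsize n b L μ := by
  have hα := alpha_pos hb hbn
  rw [stepsize, sub_pos]
  refine Real.lt_sqrt_of_sq_lt ?_
  have : 0 < 1 / (4 * μ * alpha n b * L) := by positivity
  linarith

/-- The stepsize is the positive root of `4 μ α L h² + 8 (1 + e) α L h = 1`. -/
lemma stepsize_eq {b : ℕ} {L μ : ℝ} (hL : 0 < L) (hμ : 0 < μ) (hb : 1 ≤ b) (hbn : b < n) :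
    4 * μ * alpha n b * L * stepsize n b L μ ^ 2
      + 8 * (1 + Real.exp 1) * alpha n b * L * stepsize n b L μ = 1 := by
  have hα := alpha_pos hb hbn
  have h1 : (stepsize n b L μ + (1 + Real.exp 1) / μ) ^ 2
      = ((1 + Real.exp 1) / μ) ^ 2 + 1 / (4 * μ * alpha n b * L) := by
    rw [stepsize, sub_add_cancel, Real.sq_sqrt (by positivity)]
  set h := stepsize n b L μ
  have h2 : h ^ 2 + 2 * ((1 + Real.exp 1) / μ) * h = 1 / (4 * μ * alpha n b * L) := by linarith
  calc 4 * μ * alpha n b * L * h ^ 2 + 8 * (1 + Real.exp 1) * alpha n b * L * h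
      = 4 * μ * alpha n b * L * (h ^ 2 + 2 * ((1 + Real.exp 1) / μ) * h) := by
        field_simp
        ring
    _ = 1 := by
        rw [h2]
        field_simp

/-- Below the threshold the stepsize is at most `1 / L`. -/
lemma stepsize_mul_le_one {b : ℕ} {L μ : ℝ} (hL : 0 < L) (hμ : 0 < μ) (hb : 1 ≤ b) (hbn : b < n)
    (h : b < ⌈threshold n (L / μ)⌉₊) : stepsize n b L μ * L ≤ 1 := by
  have hα := alpha_pos hb hbn
  have h1 := le_alpha_mul_of_lt_threshold (div_pos hL hμ) hb hbn h
  have h2 := stepsize_eq hL hμ hb hbn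
  set s := stepsize n b L μ
  have h3 : L ≤ alpha n b * (4 * μ + 8 * (1 + Real.exp 1) * L) := by
    have := mul_le_mul_of_nonneg_right h1 hμ.le
    have e : alpha n b * (4 + 8 * (1 + Real.exp 1) * (L / μ)) * μ
        = alpha n b * (4 * μ + 8 * (1 + Real.exp 1) * L) := by
      field_simp
    rwa [e, div_mul_cancel₀ _ hμ.ne'] at this
  by_contra! hlt
  have h4 : 1 < (s * L) ^ 2 := by nlinarith
  have h5 : 4 * μ * alpha n b * 1 < 4 * μ * alpha n b * (s * L) ^ 2 := by gcongr
  have h6 : 8 * (1 + Real.exp 1) * alpha n b * L * 1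
      < 8 * (1 + Real.exp 1) * alpha n b * L * (s * L) := by gcongr
  have h7 : 4 * μ * alpha n b * (s * L) ^ 2 + 8 * (1 + Real.exp 1) * alpha n b * L * (s * L)
      = L := by
    linear_combination L * h2
  linarith

lemma two_exp_le_innerLength_mul {b : ℕ} {L μ : ℝ} (hL : 0 < L) (hμ : 0 < μ) (hb : 1 ≤ b)
    (hbn : b < n) :
    2 * Real.exp 1 ≤ innerLength n b (L / μ) * (μ * stepsize n b L μ) := by
  have hα := alpha_pos hb hbn
  have hs := stepsize_pos hL hμ hb hbn
  have hq := stepsize_eq hL hμ hb hbn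
  have hsqrt : √(1 / (4 * alpha n b * (L / μ)) + (1 + Real.exp 1) ^ 2)
      = μ * stepsize n b L μ + (1 + Real.exp 1) := by
    have e : 1 / (4 * alpha n b * (L / μ)) + (1 + Real.exp 1) ^ 2
        = μ ^ 2 * (((1 + Real.exp 1) / μ) ^ 2 + 1 / (4 * μ * alpha n b * L)) := by
      field_simp
      ring
    rw [e, Real.sqrt_mul (sq_nonneg μ), Real.sqrt_sq hμ.le, stepsize, mul_sub,
      mul_div_cancel₀ _ hμ.ne', sub_add_cancel]
  have hceil : 8 * Real.exp 1 * alpha n b * (L / μ) *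
      (Real.exp 1 + 1 + (μ * stepsize n b L μ + (1 + Real.exp 1))) ≤ innerLength n b (L / μ) := by
    rw [← hsqrt]
    exact Nat.le_ceil _
  set s := stepsize n b L μ
  calc 2 * Real.exp 1 = 8 * Real.exp 1 * alpha n b * (L / μ) *
        (Real.exp 1 + 1 + (μ * s + (1 + Real.exp 1))) * (μ * s) := by
        field_simp
        linear_combination (-2) * hq
    _ ≤ _ := by gcongr

lemma innerLength_pos {b : ℕ} {κ : ℝ} (hκ : 0 < κ) (hb : 1 ≤ b) (hbn : b < n) :
    0 < innerLength n b κ := by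
  have hα := alpha_pos hb hbn
  exact Nat.ceil_pos.2 (by positivity)

lemma stepsize_small {b : ℕ} {L μ : ℝ} (hL : 0 < L) (hμ : 0 < μ) (hb : 1 ≤ b) (hbn : b < n) :
    8 * stepsize n b L μ ^ 2 * L * alpha n b < 2 * stepsize n b L μ := by
  have hα := alpha_pos hb hbn
  have hs := stepsize_pos hL hμ hb hbn
  have hq := stepsize_eq hL hμ hb hbn
  set s := stepsize n b L μ
  have h1 : 0 < 4 * μ * alpha n b * L * s ^ 2 := by positivity
  have h2 : 0 < alpha n b * L * s := by positivity
  have h3 : 4 * alpha n b * L * s < 1 := by nlinarith [Real.exp_pos 1]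
  nlinarith

/-- With the prescribed stepsize and inner-loop length the contraction factor is at most `1/e`. In
terms of `q = 4 μ α L h²` and `u = 8 (1 + e) α L h` one has `q + u = 1` and
`(1 + e) q = μ h u / 2`, and the claim reduces to `e (1 + q) ≤ m μ h (1 - u / 2)`. -/
lemma rate_le {b : ℕ} {L μ : ℝ} (hL : 0 < L) (hμ : 0 < μ) (hb : 1 ≤ b) (hbn : b < n) :
    2 / μ + 8 * stepsize n b L μ ^ 2 * L * alpha n b * (innerLength n b (L / μ) + 1)
      ≤ Real.exp (-1) * ((2 * stepsize n b L μ - 8 * stepsize n b L μ ^ 2 * L * alpha n b)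
        * innerLength n b (L / μ)) := by
  have hα := alpha_pos hb hbn
  have hs := stepsize_pos hL hμ hb hbn
  have hq := stepsize_eq hL hμ hb hbn
  have hm := two_exp_le_innerLength_mul hL hμ hb hbn
  have he := Real.exp_pos 1
  set s := stepsize n b L μ
  set m : ℝ := (innerLength n b (L / μ) : ℝ)
  set e := Real.exp 1
  set u := 8 * (1 + e) * alpha n b * L * s with hu
  have hq0 : 0 < 4 * μ * alpha n b * L * s ^ 2 := by positivity
  have hu1 : 0 ≤ 1 - u / 2 := by linarith
  have h1 := mul_le_mul_of_nonneg_right hm hu1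
  rw [Real.exp_neg, inv_mul_eq_div, le_div_iff₀ he]
  refine le_of_mul_le_mul_right ?_ hμ
  have hqu : 1 - u = 4 * μ * alpha n b * L * s ^ 2 := by linarith
  have e1 : (2 / μ + 8 * s ^ 2 * L * alpha n b * (m + 1)) * e * μ
      = 2 * e + 2 * e * (1 - u) * (m + 1) := by
    rw [hqu]
    field_simp
    ring
  have e2 : (2 * s - 8 * s ^ 2 * L * alpha n b) * m * μ = 2 * m * (μ * s - (1 - u)) := by
    rw [hqu]
    ring
  have e3 : (1 + e) * (1 - u) = μ * s * u / 2 := by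
    rw [hqu, hu]
    ring
  rw [e1, e2]
  have e4 : m * ((1 + e) * (1 - u)) = m * (μ * s * u / 2) := by rw [e3]
  linarith

/-- The bound `b m_b ≤ C₁ κ + C₂`, by `√y ≤ y + 1` and `α(b) ≤ 1`. -/
lemma exists_mul_innerLength_le : ∃ C : ℝ, 0 < C ∧ ∀ (n b : ℕ) (κ : ℝ), 1 ≤ b → b ≤ 29 → b < n →
    0 < κ → (b : ℝ) * innerLength n b κ ≤ C * κ + C := by
  set e := Real.exp 1
  have he : 0 < e := Real.exp_pos 1
  set D := 8 * e * (e + 1 + (1 + e) ^ 2 + 1) + 2 * e + 1 with hD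
  refine ⟨29 * D, by positivity, fun n b κ hb hb29 hbn hκ => ?_⟩
  have hα := alpha_pos hb hbn
  have hα1 := alpha_le_one hb hbn
  have hb' : (b : ℝ) ≤ 29 := by exact_mod_cast hb29
  set y := 1 / (4 * alpha n b * κ) + (1 + e) ^ 2 with hy
  have hsqrt : √y ≤ y + 1 := Real.sqrt_le_iff.2 ⟨by positivity, by
    have : 0 ≤ y := by positivity
    nlinarith⟩
  have hx0 : 0 ≤ 8 * e * alpha n b * κ * (e + 1 + √y) := by positivity
  have hx : 8 * e * alpha n b * κ * (e + 1 + √y) ≤ 8 * e * (e + 1 + (1 + e) ^ 2 + 1) * κ + 2 * e :=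
    calc 8 * e * alpha n b * κ * (e + 1 + √y)
        ≤ 8 * e * alpha n b * κ * (e + 1 + (y + 1)) := by gcongr
      _ = 8 * e * (e + 1 + (1 + e) ^ 2 + 1) * (alpha n b * κ) + 2 * e := by
          rw [hy]
          field_simp
          ring
      _ ≤ 8 * e * (e + 1 + (1 + e) ^ 2 + 1) * (1 * κ) + 2 * e := by gcongr
      _ = _ := by ring
  have hm : (innerLength n b κ : ℝ) ≤ D * κ + D := by
    have h1 : (innerLength n b κ : ℝ) < 8 * e * alpha n b * κ * (e + 1 + √y) + 1 :=
      Nat.ceil_lt_add_one hx0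
    have h2 : 0 ≤ (2 * e + 1) * κ := by positivity
    have h3 : 0 ≤ 8 * e * (e + 1 + (1 + e) ^ 2 + 1) := by positivity
    rw [hD]
    linarith
  calc (b : ℝ) * innerLength n b κ ≤ 29 * (D * κ + D) := by gcongr
    _ = _ := by ring

lemma exp_neg_one_pow_outerIterations_le {ε : ℝ} (hε : 0 < ε) :
    ENNReal.ofReal (Real.exp (-1)) ^ outerIterations ε ≤ ENNReal.ofReal ε := by
  rw [← ENNReal.ofReal_pow (Real.exp_pos _).le, ← Real.exp_nat_mul]
  refine ENNReal.ofReal_le_ofReal ?_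
  have h1 : Real.log (1 / ε) ≤ outerIterations ε := Nat.le_ceil _
  rw [one_div, Real.log_inv] at h1
  calc Real.exp (outerIterations ε * -1) ≤ Real.exp (Real.log ε) := by
        gcongr
        linarith
    _ = ε := Real.exp_log hε

lemma outerIterations_le {ε₀ ε : ℝ} (h1 : ε₀ < 1) (hε : 0 < ε) (hle : ε ≤ ε₀) :
    (outerIterations ε : ℝ) ≤ (1 + 1 / Real.log (1 / ε₀)) * Real.log (1 / ε) := by
  have h0 : 0 < ε₀ := hε.trans_le hle
  have hl0 : 0 < Real.log (1 / ε₀) := Real.log_pos (by rw [lt_div_iff₀ h0]; linarith)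
  have hl : Real.log (1 / ε₀) ≤ Real.log (1 / ε) := by gcongr
  have h2 : (outerIterations ε : ℝ) < Real.log (1 / ε) + 1 := Nat.ceil_lt_add_one (hl0.le.trans hl)
  have h3 : 1 ≤ 1 / Real.log (1 / ε₀) * Real.log (1 / ε) := by
    rw [one_div_mul_eq_div, le_div_iff₀ hl0]
    linarith
  linarith

/-- The value `1118` is the least integer `n` with `(8 e - 21) n > 203 + 232 e`, the coefficient
condition for `κ` at `b = 29`. -/
lemma lt_ceil_threshold_of_large {b : ℕ} {κ : ℝ} (hn : 1118 ≤ n) (hκ : 0 < κ) (hb : b ≤ 29) :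
    b < ⌈threshold n κ⌉₊ := by
  rw [lt_ceil_threshold_iff hκ]
  have hn' : (1118 : ℝ) ≤ n := by exact_mod_cast hn
  have hb' : (b : ℝ) ≤ 29 := by exact_mod_cast hb
  have he := Real.exp_one_gt_d9
  set e := Real.exp 1
  have h1 : 203 + 232 * e < (8 * e - 21) * n := by nlinarith
  have h2 := mul_lt_mul_of_pos_right h1 hκ
  calc (b : ℝ) * (n * κ + (7 + 8 * e) * κ + 4) ≤ 29 * (n * κ + (7 + 8 * e) * κ + 4) := by gcongr
    _ < _ := by linarith

end MS2GD

end

theorem corollary1 :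
    -- accuracy in expectation, and the bound on the work, of `x_k` for `k = ⌈log (1/ε)⌉`
    (∀ (d n b : ℕ) (L μ ε : ℝ), 1 ≤ b → b ≤ 29 → ∀ hbn : b ≤ n, 0 < L → 0 < μ → 0 < ε → ε < 1 →
      b < ⌈MS2GD.threshold n (L / μ)⌉₊ →
      ∀ (f : Fin n → MS2GD.E d → ℝ) (R : MS2GD.E d → EReal) (x₀ xstar : MS2GD.E d),
        (∀ i, MS2GD.SmoothConvex (f i) L) →
        MS2GD.ProperClosedConvex R →
        MS2GD.StronglyConvex (MS2GD.objective f R) μ →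
        (∀ x, MS2GD.objective f R xstar ≤ MS2GD.objective f R x) →
        ∃ hm : 0 < MS2GD.innerLength n b (L / μ),
          MS2GD.expectation
              (MS2GD.run f R (MS2GD.stepsize n b L μ) hbn hm x₀ (MS2GD.outerIterations ε))
              (fun s => MS2GD.gap (MS2GD.objective f R) xstar s.1)
            ≤ ENNReal.ofReal ε * MS2GD.gap (MS2GD.objective f R) xstar x₀ ∧
          ∀ s ∈ (MS2GD.run f R (MS2GD.stepsize n b L μ) hbn hm x₀
              (MS2GD.outerIterations ε)).support,
            s.2 ≤ (n + 2 * b * MS2GD.innerLength n b (L / μ)) * MS2GD.outerIterations ε) ∧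
    -- `b m_b = O(κ)`
    (∀ κ₀ : ℝ, 0 < κ₀ → ∃ C : ℝ, ∀ (n b : ℕ) (κ : ℝ), 1 ≤ b → b ≤ 29 → b ≤ n → κ₀ ≤ κ →
      b < ⌈MS2GD.threshold n κ⌉₊ →
      (b : ℝ) * MS2GD.innerLength n b κ ≤ C * κ) ∧
    -- the total work is `O((n + κ) log (1/ε))`
    (∀ ε₀ : ℝ, 0 < ε₀ → ε₀ < 1 → ∃ C : ℝ, ∀ (n b : ℕ) (κ ε : ℝ), 1 ≤ b → b ≤ 29 → b ≤ n →
      0 < κ → 0 < ε → ε ≤ ε₀ → b < ⌈MS2GD.threshold n κ⌉₊ →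
      ((n : ℝ) + 2 * b * MS2GD.innerLength n b κ) * MS2GD.outerIterations ε
        ≤ C * ((n + κ) * Real.log (1 / ε))) ∧
    -- for large `n`, every mini-batch size `b ≤ 29` is below the threshold
    (∀ (n b : ℕ) (κ : ℝ), 1118 ≤ n → 0 < κ → b ≤ 29 → b < ⌈MS2GD.threshold n κ⌉₊) := by
  refine ⟨?_, ?_, ?_, fun n b κ hn hκ hb => MS2GD.lt_ceil_threshold_of_large hn hκ hb⟩
  · intro d n b L μ ε hb _ hbn hL hμ hε _ hthr f R x₀ xstar hf hR hP hmin
    have hlt := MS2GD.lt_of_lt_threshold (div_pos hL hμ) hb hbn hthr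
    have hp : MS2GD.CompositeProblem f R L μ xstar :=
      ⟨by omega, hL, hμ, hf, hR, hP, hmin⟩
    have hm := MS2GD.innerLength_pos (div_pos hL hμ) hb hlt
    refine ⟨hm, ?_, fun s hs => MS2GD.work_run_le _ s hs⟩
    refine (hp.expectation_run_le (MS2GD.stepsize_pos hL hμ hb hlt)
      (MS2GD.stepsize_mul_le_one hL hμ hb hlt hthr) hb hlt hm (Real.exp_pos (-1))
      (MS2GD.stepsize_small hL hμ hb hlt) (MS2GD.rate_le hL hμ hb hlt) x₀ _).trans ?_
    gcongr
    exact MS2GD.exp_neg_one_pow_outerIterations_le hε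
  · intro κ₀ hκ₀
    obtain ⟨C, hC, hle⟩ := MS2GD.exists_mul_innerLength_le
    refine ⟨C + C / κ₀, fun n b κ hb hb29 hbn hκ hthr => ?_⟩
    have hκ0 : 0 < κ := hκ₀.trans_le hκ
    refine (hle n b κ hb hb29 (MS2GD.lt_of_lt_threshold hκ0 hb hbn hthr) hκ0).trans ?_
    have h1 : C ≤ C / κ₀ * κ := by
      rw [div_mul_eq_mul_div, le_div_iff₀ hκ₀]
      gcongr
    linarith
  · intro ε₀ _ hε₀1
    obtain ⟨C, hC, hle⟩ := MS2GD.exists_mul_innerLength_le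
    refine ⟨(1 + 4 * C) * (1 + 1 / Real.log (1 / ε₀)),
      fun n b κ ε hb hb29 hbn hκ hε hεle hthr => ?_⟩
    have h1 := hle n b κ hb hb29 (MS2GD.lt_of_lt_threshold hκ hb hbn hthr) hκ
    have h2 := MS2GD.outerIterations_le hε₀1 hε hεle
    have hn : (1 : ℝ) ≤ n := by exact_mod_cast hb.trans hbn
    have h3 : C ≤ C * (n + κ) := le_mul_of_one_le_right hC.le (by linarith)
    have h4 : (n : ℝ) + 2 * b * MS2GD.innerLength n b κ ≤ (1 + 4 * C) * (n + κ) := by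
      have h5 : 0 ≤ C * n := by positivity
      linarith
    calc ((n : ℝ) + 2 * b * MS2GD.innerLength n b κ) * MS2GD.outerIterations ε
        ≤ (1 + 4 * C) * (n + κ)
          * ((1 + 1 / Real.log (1 / ε₀)) * Real.log (1 / ε)) := by gcongr
      _ = _ := by ring
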